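/- Let $\kappa$ be a regular cardinal and let $\alpha<\kappa$ be a $\kappa$-small ordinal, regarded as a category via its order, with one arrow $\beta\to\gamma$ whenever $\beta\le\gamma$. Let $\mathcal{C}_\bullet:\alpha^{\mathrm{op}}\to\mathbf{Cat}$ be a tower of locally small categories (a pseudofunctor; in particular any strict functor is allowed), $$\mathcal{C}_0\leftarrow\mathcal{C}_1\leftarrow\cdots\leftarrow\mathcal{C}_\gamma\leftarrow\cdots .$$ All limits below are pseudo-limits of categories. Assume that for each $\gamma<\alpha$ the comparison functor $$\mathcal{C}_\gamma\longrightarrow\lim_{\beta<\gamma}\mathcal{C}_\beta$$ is equivalent to a cartesian (Grothendieck) fibration; equivalently, it is a Street fibration, where $P:E\to B$ is a Street fibration if for every $e\in E$ and every $f:b\to P(e)$ in $B$ there are a $P$-cartesian arrow $\varphi:e'\to e$ and an isomorphism $h:P(e')\cong b$ with $P(\varphi)=f\circ h$. For a locally small category $\mathcal{C}$ let $\mathrm{Ind}_\kappa(\mathcal{C})$ be its $\kappa$-ind-completion, i.e. the full subcategory of the presheaves $\mathcal{C}^{\mathrm{op}}\to\mathbf{Sets}$ that are small $\kappa$-filtered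 colimits of representables; it is (pseudo)functorial in $\mathcal{C}$, a functor $F$ acting by its extension preserving $\kappa$-filtered colimits (left Kan extension). Then the limit $\lim_{\beta<\alpha}\mathcal{C}_\beta$ is preserved by $\mathrm{Ind}_\kappa$: the canonical functor $$\mathrm{Ind}_\kappa\Bigl(\lim_{\beta<\alpha}\mathcal{C}_\beta\Bigr)\longrightarrow\lim_{\beta<\alpha}\mathrm{Ind}_\kappa(\mathcal{C}_\beta)$$ induced by the projections is an equivalence of categories. -/

import Mathlib

open CategoryTheory Bicategory Opposite Limits

universe v u

namespace IndTower

universe w x v₁ u₁ v₂ u₂ w₁ w₂ v₃ u₃ w₃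

/-! ### Pseudo-cones and pseudo-limits -/

section PseudoLimits

variable {J : Type u₁} [Category.{v₁} J]

/-- A pseudo-cone with apex `L` over a diagram `F` indexed by the category `J` in a bicategory:
1-cells `π j : L ⟶ F j` and invertible 2-cells `π i ≫ F f ≅ π j`, coherent with identities
and composition. -/
structure PseudoCone {B : Type u₂} [Bicategory.{w₂, v₂} B] (F : LocallyDiscrete J ⥤ᵖ B)
    (L : B) where
  /-- The projections. -/
  π (j : J) : L ⟶ F.obj ⟨j⟩
  /-- The compatibility 2-isomorphisms. -/
  iso {i j : J} (f : i ⟶ j) : π i ≫ F.map f.toLoc ≅ π j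
  iso_id (j : J) :
    (iso (𝟙 j)).hom = π j ◁ (F.mapId ⟨j⟩).hom ≫ (ρ_ (π j)).hom
  iso_comp {i j k : J} (f : i ⟶ j) (g : j ⟶ k) :
    (iso (f ≫ g)).hom = π i ◁ (F.mapComp f.toLoc g.toLoc).hom ≫
      (α_ (π i) (F.map f.toLoc) (F.map g.toLoc)).inv ≫ (iso f).hom ▷ F.map g.toLoc ≫ (iso g).hom

/-- The image of a pseudo-cone under a pseudofunctor. -/
def PseudoCone.map {B : Type u₂} [Bicategory.{w₂, v₂} B] {B' : Type u₃} [Bicategory.{w₃, v₃} B']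
    {F : LocallyDiscrete J ⥤ᵖ B} {L : B} (c : PseudoCone F L) (G : B ⥤ᵖ B') :
    PseudoCone (F.comp G) (G.obj L) where
  π j := G.map (c.π j)
  iso f := (G.mapComp _ _).symm ≪≫ G.map₂Iso (c.iso f)
  iso_id j := by
    change (G.mapComp (c.π j) (F.map (𝟙 _))).inv ≫ G.map₂ (c.iso (𝟙 j)).hom =
      G.map (c.π j) ◁ (G.map₂ (F.mapId ⟨j⟩).hom ≫ (G.mapId _).hom) ≫ (ρ_ _).hom
    rw [c.iso_id, Iso.inv_comp_eq]
    simp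
  iso_comp {i j k} f g := by
    change (G.mapComp (c.π i) (F.map (f.toLoc ≫ g.toLoc))).inv ≫ G.map₂ (c.iso (f ≫ g)).hom =
      G.map (c.π i) ◁ (G.map₂ (F.mapComp f.toLoc g.toLoc).hom ≫ (G.mapComp _ _).hom) ≫
        (α_ _ _ _).inv ≫ ((G.mapComp _ _).inv ≫ G.map₂ (c.iso f).hom) ▷ G.map (F.map g.toLoc) ≫
          (G.mapComp _ _).inv ≫ G.map₂ (c.iso g).hom
    rw [c.iso_comp, Iso.inv_comp_eq]
    have key : (G.mapComp (c.π i) (F.map f.toLoc ≫ F.map g.toLoc)).inv ≫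
        G.map₂ (α_ (c.π i) (F.map f.toLoc) (F.map g.toLoc)).inv ≫
          (G.mapComp (c.π i ≫ F.map f.toLoc) (F.map g.toLoc)).hom =
        G.map (c.π i) ◁ (G.mapComp (F.map f.toLoc) (F.map g.toLoc)).hom ≫
          (α_ _ _ _).inv ≫ (G.mapComp (c.π i) (F.map f.toLoc)).inv ▷ G.map (F.map g.toLoc) := by
      rw [← cancel_mono (G.mapComp (c.π i ≫ F.map f.toLoc) (F.map g.toLoc)).inv]
      simp only [Category.assoc, Iso.hom_inv_id, Category.comp_id, G.mapComp_assoc_left_inv]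
      simp
    simp only [PrelaxFunctor.map₂_comp, Pseudofunctor.map₂_whisker_left,
      Pseudofunctor.map₂_whisker_right, Category.assoc,
      Bicategory.whiskerLeft_comp, Bicategory.comp_whiskerRight]
    congr 2
    simpa only [Category.assoc] using
      congr($key ≫ G.map₂ (c.iso f).hom ▷ G.map (F.map g.toLoc) ≫
        (G.mapComp (c.π j) (F.map g.toLoc)).inv ≫ G.map₂ (c.iso g).hom)

theorem mapComp'_inv_of_eq_id {B : Type u₂} [Bicategory.{w₂, v₂} B]
    (F : LocallyDiscrete J ⥤ᵖ B) {i j : LocallyDiscrete J} (f : i ⟶ j) (e : j ⟶ j) (he : e = 𝟙 j)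
    (h : f ≫ e = f) :
    (F.mapComp' f e f h).inv =
      F.map f ◁ (F.map₂Iso (eqToIso he) ≪≫ F.mapId j).hom ≫ (ρ_ (F.map f)).hom := by
  subst he
  rw [F.mapComp'_comp_id_inv]
  change _ = F.map f ◁ (F.map₂ (𝟙 _) ≫ (F.mapId j).hom) ≫ _
  simp

theorem toLoc_comp_naturality {I : Type w₁} [Category.{w} I] {K : I ⥤ J} {j : J}
    (a : (Functor.const I).obj j ⟶ K) {i i' : I} (f : i ⟶ i') :
    (a.app i).toLoc ≫ (K.map f).toLoc = (a.app i').toLoc := by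
  rw [← Quiver.Hom.comp_toLoc, ← a.naturality f]
  simp

/-- A cone `a` in `J` with apex `j` over a functor `K : I ⥤ J` is sent by a diagram `F`
on `J` to a pseudo-cone with apex `F j` over the restricted diagram `F ∘ K`. -/
def PseudoCone.ofNatTrans {B : Type u₂} [Bicategory.{w₂, v₂} B]
    (F : LocallyDiscrete J ⥤ᵖ B) {I : Type w₁} [Category.{w} I] (K : I ⥤ J) (j : J)
    (a : (Functor.const I).obj j ⟶ K) :
    PseudoCone (K.toPseudofunctor.comp F) (F.obj ⟨j⟩) where
  π i := F.map (a.app i).toLoc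
  iso {i i'} f := (F.mapComp' (a.app i).toLoc (K.map f).toLoc (a.app i').toLoc
    (toLoc_comp_naturality a f)).symm
  iso_id i := mapComp'_inv_of_eq_id F (a.app i).toLoc (K.map (𝟙 i)).toLoc (by simp)
    (toLoc_comp_naturality a (𝟙 i))
  iso_comp {i i' i''} f g :=
    F.mapComp'₀₁₃_inv (a.app i).toLoc (K.map f).toLoc (K.map g).toLoc (a.app i').toLoc
      (K.map (f ≫ g)).toLoc (a.app i'').toLoc
      (toLoc_comp_naturality a f) (by simp) (toLoc_comp_naturality a (f ≫ g))

/-- The (objects of the) pseudo-limit of a diagram `F` of categories: families of objects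
`X j : F j` together with coherent isomorphisms `F f (X i) ≅ X j`. -/
structure PseudoLimit (F : LocallyDiscrete J ⥤ᵖ Cat.{v, u}) where
  /-- The components. -/
  obj (j : J) : F.obj ⟨j⟩
  /-- The compatibility isomorphisms. -/
  iso {i j : J} (f : i ⟶ j) : (F.map f.toLoc).toFunctor.obj (obj i) ≅ obj j
  iso_id (j : J) : (iso (𝟙 j)).hom = (F.mapId ⟨j⟩).hom.toNatTrans.app (obj j)
  iso_comp {i j k : J} (f : i ⟶ j) (g : j ⟶ k) :
    (iso (f ≫ g)).hom = (F.mapComp f.toLoc g.toLoc).hom.toNatTrans.app (obj i) ≫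
      (F.map g.toLoc).toFunctor.map (iso f).hom ≫ (iso g).hom

namespace PseudoLimit

variable {F : LocallyDiscrete J ⥤ᵖ Cat.{v, u}}

/-- Morphisms in the pseudo-limit: families of morphisms compatible with the isomorphisms. -/
@[ext]
structure Hom (X Y : PseudoLimit F) where
  /-- The components. -/
  app (j : J) : X.obj j ⟶ Y.obj j
  naturality {i j : J} (f : i ⟶ j) :
    (F.map f.toLoc).toFunctor.map (app i) ≫ (Y.iso f).hom = (X.iso f).hom ≫ app j

instance : Category (PseudoLimit F) where
  Hom X Y := Hom X Y
  id X := { app := fun j => 𝟙 (X.obj j), naturality := by simp }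
  comp a b :=
    { app := fun j => a.app j ≫ b.app j
      naturality := fun f => by
        rw [Functor.map_comp, Category.assoc, b.naturality, ← Category.assoc, a.naturality,
          Category.assoc] }
  id_comp a := Hom.ext (funext fun j => Category.id_comp _)
  comp_id a := Hom.ext (funext fun j => Category.comp_id _)
  assoc a b c := Hom.ext (funext fun j => Category.assoc _ _ _)

/-- The projections of the pseudo-limit. -/
def proj (F : LocallyDiscrete J ⥤ᵖ Cat.{v, u}) (j : J) : PseudoLimit F ⥤ F.obj ⟨j⟩ where
  obj X := X.obj j
  map a := a.app j
  map_id _ := rfl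
  map_comp _ _ := rfl

end PseudoLimit

/-- The functor to the pseudo-limit induced by a pseudo-cone of categories. -/
def PseudoCone.lift {F : LocallyDiscrete J ⥤ᵖ Cat.{v, u}} {L : Cat.{v, u}} (c : PseudoCone F L) :
    L ⥤ PseudoLimit F where
  obj X :=
    { obj := fun j => (c.π j).toFunctor.obj X
      iso := fun f => (Cat.Hom.toNatIso (c.iso f)).app X
      iso_id := fun j => by
        have := congr(($(c.iso_id j)).toNatTrans.app X)
        exact this.trans (by simp)
      iso_comp := fun {i j k} f g => by
        have := congr(($(c.iso_comp f g)).toNatTrans.app X)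
        exact this.trans (by simp) }
  map a :=
    { app := fun j => (c.π j).toFunctor.map a
      naturality := fun f => (c.iso f).hom.toNatTrans.naturality a }
  map_id X := PseudoLimit.Hom.ext (funext fun j => by exact (c.π j).toFunctor.map_id X)
  map_comp a b := PseudoLimit.Hom.ext (funext fun j => by exact (c.π j).toFunctor.map_comp a b)

/-- The canonical pseudo-cone whose apex is the pseudo-limit. -/
def PseudoLimit.cone {J : Type v} [Category.{v} J] (F : LocallyDiscrete J ⥤ᵖ Cat.{v, max u v}) :
    PseudoCone F (Cat.of (PseudoLimit F)) where
  π j := (PseudoLimit.proj F j).toCatHom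
  iso f := Cat.Hom.isoMk (NatIso.ofComponents (fun X => X.iso f) (fun a => a.naturality f))
  iso_id j := by
    ext X
    exact (X.iso_id j).trans (Category.comp_id _).symm
  iso_comp f g := by
    ext X
    refine (X.iso_comp f g).trans ?_
    exact congrArg (_ ≫ ·) (Category.id_comp _).symm

/-- A pseudofunctor `G` preserves the pseudo-limit of `F` if it sends the canonical pseudo-cone
to a pseudo-limit cone, that is, if the canonical functor `G (lim F) ⥤ lim (G ∘ F)` is an
equivalence of categories. -/
def PreservesPseudoLimit {J : Type v} [Category.{v} J] (G : Cat.{v, max u v} ⥤ᵖ Cat.{w, x})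
    (F : LocallyDiscrete J ⥤ᵖ Cat.{v, max u v}) : Prop :=
  ((PseudoLimit.cone.{v, u} F).map G).lift.IsEquivalence

end PseudoLimits

/-! ### The pseudofunctor `Ind κ` -/

section Ind

theorem adj_hom₂_ext_right {B : Type*} [Bicategory B] {a b : Adj B} {x y : a ⟶ b} {p q : x ⟶ y}
    (h : p.τr = q.τr) : p = q :=
  Adj.hom₂_ext (by rw [← p.conjugateEquiv_symm_τr, ← q.conjugateEquiv_symm_τr, h])

/-- A 2-cell between adjunctions determined by its component on right adjoints. -/
def homOfRight {B : Type*} [Bicategory B] {a b : Adj B} {x y : a ⟶ b}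
    (h : y.r ⟶ x.r) : x ⟶ y where
  τl := (conjugateEquiv y.adj x.adj).symm h
  τr := h

/-- An invertible 2-cell between adjunctions determined by its component on right adjoints. -/
def isoOfRight {B : Type*} [Bicategory B] {a b : Adj B} {x y : a ⟶ b}
    (e : y.r ≅ x.r) : x ≅ y where
  hom := homOfRight e.hom
  inv := homOfRight e.inv
  hom_inv_id := adj_hom₂_ext_right (by simp [homOfRight])
  inv_hom_id := adj_hom₂_ext_right (by simp [homOfRight])

/-- The pseudofunctor sending a category `C` to its category of presheaves and a functor `F`
to the adjunction between left Kan extension along `F.op` and precomposition with `F.op`. -/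
noncomputable def presheafAdj : Cat.{v, max u v} ⥤ᵖ Adj Cat.{max u v, (max u v) + 1} where
  obj C := ⟨Cat.of (Cᵒᵖ ⥤ Type (max u v))⟩
  map {C D} F := ⟨(F.toFunctor.op.lanAdjunction (Type (max u v))).toCat⟩
  map₂ {C D F G} σ := homOfRight
    ((Functor.whiskeringLeft _ _ (Type (max u v))).map (NatTrans.op σ.toNatTrans)).toCatHom₂
  map₂_id _ := by
    apply adj_hom₂_ext_right
    ext P
    simp [homOfRight]
  map₂_comp σ τ := by
    apply adj_hom₂_ext_right
    ext P
    simp [homOfRight]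
  mapId C := isoOfRight (Cat.Hom.isoMk (Iso.refl _))
  mapComp F G := isoOfRight (Cat.Hom.isoMk (Iso.refl _))
  map₂_whisker_left F _ _ σ := by
    apply adj_hom₂_ext_right
    ext P
    simp only [homOfRight, isoOfRight]
    refine NatTrans.ext (funext fun X => ?_)
    rfl
  map₂_whisker_right σ F := by
    apply adj_hom₂_ext_right
    ext P
    simp only [homOfRight, isoOfRight]
    refine NatTrans.ext (funext fun X => ?_)
    rfl
  map₂_associator F G H := by
    apply adj_hom₂_ext_right
    ext P
    simp only [homOfRight, isoOfRight]
    refine NatTrans.ext (funext fun X => ?_)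
    exact P.map_id _
  map₂_left_unitor F := by
    apply adj_hom₂_ext_right
    ext P
    simp only [homOfRight, isoOfRight]
    refine NatTrans.ext (funext fun X => ?_)
    exact P.map_id _
  map₂_right_unitor F := by
    apply adj_hom₂_ext_right
    ext P
    simp only [homOfRight, isoOfRight]
    refine NatTrans.ext (funext fun X => ?_)
    exact P.map_id _

/-- The covariant presheaf pseudofunctor, acting on functors by left Kan extension. -/
noncomputable def presheaf : Cat.{v, max u v} ⥤ᵖ Cat.{max u v, (max u v) + 1} :=
  presheafAdj.{v, u}.comp Adj.forget₁

/-- A presheaf on `C` is a `κ`-ind-object if it is the colimit of a diagram of representable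
presheaves indexed by a small `κ`-filtered category. Here "small" refers to the universe `v` of
the hom-sets of `C`; the objects of `C` may form a larger type, and then the values of
presheaves are lifted to the larger universe, which does not change the resulting category
up to equivalence. -/
def IsIndObj (κ : Cardinal.{v}) [Fact κ.IsRegular] {C : Type (max u v)} [Category.{v} C]
    (P : Cᵒᵖ ⥤ Type (max u v)) : Prop :=
  ∃ (I : Type v) (_ : SmallCategory I) (_ : IsCardinalFiltered I κ) (D : I ⥤ C)
    (ι : D ⋙ uliftYoneda.{max u v} ⟶ (Functor.const I).obj P), Nonempty (IsColimit (Cocone.mk P ι))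

theorem IsIndObj.lan {κ : Cardinal.{v}} [Fact κ.IsRegular] {C D : Type (max u v)} [Category.{v} C]
    [Category.{v} D] (F : C ⥤ D) {P : Cᵒᵖ ⥤ Type (max u v)} (hP : IsIndObj.{v, u} κ P) :
    IsIndObj.{v, u} κ (F.op.lan.obj P) := by
  obtain ⟨I, _, hI, K, ι, ⟨h⟩⟩ := hP
  have : PreservesColimitsOfSize.{v, v} (F.op.lan (H := Type (max u v))) :=
    (F.op.lanAdjunction (Type (max u v))).leftAdjoint_preservesColimits
  have h' := isColimitOfPreserves (F.op.lan (H := Type (max u v))) h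
  let e : (K ⋙ F) ⋙ uliftYoneda.{max u v} ≅ (K ⋙ uliftYoneda.{max u v}) ⋙ F.op.lan :=
    Functor.isoWhiskerLeft K (Presheaf.compULiftYonedaIsoULiftYonedaCompLan.{max u v} F)
  exact ⟨I, inferInstance, hI, K ⋙ F, _, ⟨(IsColimit.precomposeHomEquiv e _).symm h'⟩⟩

/-- The property of being a `κ`-ind-object, on all presheaf categories. -/
def indProperty (κ : Cardinal.{v}) [Fact κ.IsRegular] :
    Pseudofunctor.ObjectProperty presheaf.{v, u} where
  prop C P := IsIndObj.{v, u} (C := C) κ P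

instance (κ : Cardinal.{v}) [Fact κ.IsRegular] :
    (indProperty.{v, u} κ).IsClosedUnderMapObj where
  map_obj hM F := IsIndObj.lan F.toFunctor hM

/-- The `κ`-ind-completion pseudofunctor: `Ind κ C` is the full subcategory of presheaves on `C`
that are small `κ`-filtered colimits of representables, and a functor `F : C ⥤ D` acts by
left Kan extension, that is, by the extension of `F` that preserves `κ`-filtered colimits. -/
noncomputable def Ind (κ : Cardinal.{v}) [Fact κ.IsRegular] :
    Cat.{v, max u v} ⥤ᵖ Cat.{max u v, (max u v) + 1} :=
  (indProperty.{v, u} κ).fullsubcategory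

end Ind

/-! ### Towers and fibrations -/

/-- `P : E ⥤ B` is a Street fibration (equivalently: `P` is equivalent to a Grothendieck
fibration): every `f : b ⟶ P e` is, up to an isomorphism `P e' ≅ b`, the image of a cartesian
morphism `φ : e' ⟶ e`. -/
def IsStreetFibration {E : Type u₁} {B : Type u₂} [Category.{v₁} E] [Category.{v₂} B]
    (P : E ⥤ B) : Prop :=
  ∀ (e : E) (b : B) (f : b ⟶ P.obj e), ∃ (e' : E) (φ : e' ⟶ e) (h : P.obj e' ≅ b),
    P.map φ = h.hom ≫ f ∧ P.IsStronglyCartesian (P.map φ) φ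

section Tower

variable {ι : Type w} [Preorder ι]

/-- The inclusion of `{β | β < γ}` in `ι`. -/
def below (γ : ι) : (Set.Iio γ : Set ι) ⥤ ι :=
  Monotone.functor (f := fun β : (Set.Iio γ : Set ι) => (β : ι)) (fun _ _ h => h)

/-- The restriction of a tower `C` to the indices `β < γ`. -/
def restrictBelow (C : LocallyDiscrete ιᵒᵖ ⥤ᵖ Cat.{v, u}) (γ : ι) :
    LocallyDiscrete (Set.Iio γ : Set ι)ᵒᵖ ⥤ᵖ Cat.{v, u} :=
  (below γ).op.toPseudofunctor.comp C

/-- The cone in `ιᵒᵖ` with apex `γ` over the indices `β < γ`. -/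
def belowCone (γ : ι) :
    (Functor.const (Set.Iio γ : Set ι)ᵒᵖ).obj (op γ) ⟶ (below γ).op where
  app β := (homOfLE (le_of_lt β.unop.2) : (below γ).obj β.unop ⟶ γ).op
  naturality _ _ _ := Subsingleton.elim _ _

/-- The comparison functor `C γ ⥤ lim_{β < γ} C β` of a tower `C`. -/
def comparisonBelow (C : LocallyDiscrete ιᵒᵖ ⥤ᵖ Cat.{v, u}) (γ : ι) :
    C.obj ⟨op γ⟩ ⥤ PseudoLimit (restrictBelow C γ) :=
  (PseudoCone.ofNatTrans C (below γ).op (op γ) (belowCone γ)).lift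

end Tower

end IndTower

namespace IndTower

universe w x v₁ u₁ v₂ u₂ w₁ w₂ v₃ u₃ w₃

/-! ### Elementwise description of the pseudofunctor `Ind κ` -/

/-! A compatible family `X` of ind-objects has a presheaf of sections on the pseudo-limit: its
elements at `Y` are the compatible families of elements of `X j` at `Y j`. Taking sections is the
candidate inverse of the comparison functor. Ind-objects are handled through elements:
`IsPresentation` spells out what it means for a presheaf to be the filtered colimit of the
representables of a diagram.

Full faithfulness needs no fibrations. If `D` is a `κ`-filtered diagram in the pseudo-limit whose
projections present all the `X j`, then `D` presents the sections, because `κ`-filtered colimits of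
sets commute with limits over fewer than `κ` arrows (`PresheafSystem.sections_isPresentation`). For
the family induced by an ind-object `P`, a presentation of `P` is such a diagram, so `P` is
recovered as the presheaf of sections (`isIso_toSections`).

Essential surjectivity amounts to finding such a `D` for every `X`. The category `El X.sections`
should serve as its index: it must be `κ`-filtered and map cofinally to the elements of each `X j`.
Both follow from building cocones one index at a time along the well-ordered tower. At `γ`, the
cocones already built below `γ` form a cocone in the limit of the earlier categories, and the Street
fibration property of the comparison functor lifts it to `C γ`
(`IsStreetFibration.exists_lift_cocone`, `exists_compatible_stage`). Starting from nothing gives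
filteredness; starting from a cocone prescribed at `γ` and pushed down gives cofinality
(`isCardinalFiltered_el_sections`, `exists_cocone_extending`).

Finally `El X.sections` may be large, so a closing-off argument extracts a small `κ`-filtered full
subcategory that still presents every `X j` (`exists_small_isCardinalFiltered`,
`PresheafSystem.IsInd.exists_isPresentation`). -/

theorem adj_unit_comp_τr {a b : Adj Cat.{v, u}} {x y : a ⟶ b} (σ : x ⟶ y) (P : a.obj) :
    y.adj.unit.toNatTrans.app P ≫ σ.τr.toNatTrans.app (y.l.toFunctor.obj P) =
      x.adj.unit.toNatTrans.app P ≫ x.r.toFunctor.map (σ.τl.toNatTrans.app P) := by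
  have h := unit_conjugateEquiv (Adjunction.ofCat y.adj) (Adjunction.ofCat x.adj)
    σ.τl.toNatTrans P
  rw [← toNatTrans_conjugateEquiv, σ.conjugateEquiv_τl] at h
  exact h

theorem lan_hom_ext {C D : Type (max u v)} [Category.{v} C] [Category.{v} D] (F : C ⥤ D)
    (P : Cᵒᵖ ⥤ Type (max u v)) (Q : Dᵒᵖ ⥤ Type (max u v)) {a b : F.op.lan.obj P ⟶ Q}
    (h : ∀ (Y : C) (p : P.obj (op Y)),
      a.app (op (F.obj Y)) ((F.op.lanUnit.app P).app (op Y) p) =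
        b.app (op (F.obj Y)) ((F.op.lanUnit.app P).app (op Y) p)) : a = b := by
  refine (F.op.lan.obj P).hom_ext_of_isLeftKanExtension (F.op.lanUnit.app P) _ _ ?_
  ext Y p
  exact h Y.unop p

theorem exists_lan_desc {C D : Type (max u v)} [Category.{v} C] [Category.{v} D] (F : C ⥤ D)
    (P : Cᵒᵖ ⥤ Type (max u v)) (Q : Dᵒᵖ ⥤ Type (max u v)) (g : P ⟶ F.op ⋙ Q) :
    ∃ a : F.op.lan.obj P ⟶ Q, ∀ (Y : C) (p : P.obj (op Y)),
      a.app (op (F.obj Y)) ((F.op.lanUnit.app P).app (op Y) p) = g.app (op Y) p :=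
  ⟨(F.op.lan.obj P).descOfIsLeftKanExtension (F.op.lanUnit.app P) Q g, fun Y p =>
    ConcreteCategory.congr_hom (congr_app
      ((F.op.lan.obj P).descOfIsLeftKanExtension_fac (F.op.lanUnit.app P) Q g) (op Y)) p⟩

section

variable (κ : Cardinal.{v}) [Fact κ.IsRegular]

/-- The unit of the left Kan extension, on elements. -/
noncomputable def indUnit {C D : Cat.{v, max u v}} (F : C ⟶ D) (P : (Ind.{v, u} κ).obj C) {Y : C}
    (p : P.obj.obj (op Y)) :
    (((Ind.{v, u} κ).map F).toFunctor.obj P).obj.obj (op (F.toFunctor.obj Y)) :=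
  (F.toFunctor.op.lanUnit.app P.obj).app (op Y) p

variable {κ} {C D E : Cat.{v, max u v}}

theorem indUnit_map (F : C ⟶ D) (P : (Ind.{v, u} κ).obj C) {Y Y' : C} (f : Y' ⟶ Y)
    (p : P.obj.obj (op Y)) :
    indUnit κ F P (P.obj.map f.op p) =
      (((Ind.{v, u} κ).map F).toFunctor.obj P).obj.map (F.toFunctor.map f).op (indUnit κ F P p) :=
  ConcreteCategory.congr_hom ((F.toFunctor.op.lanUnit.app P.obj).naturality f.op) p

theorem ind_map_map_indUnit (F : C ⟶ D) {P Q : (Ind.{v, u} κ).obj C} (g : P ⟶ Q) {Y : C}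
    (p : P.obj.obj (op Y)) :
    (((Ind.{v, u} κ).map F).toFunctor.map g).hom.app _ (indUnit κ F P p) =
      indUnit κ F Q (g.hom.app _ p) :=
  (ConcreteCategory.congr_hom (congr_app (F.toFunctor.op.lanUnit.naturality g.hom) (op Y)) p).symm

/-- The 2-cell between Kan extensions is the mate of restriction along `σ`, and mates are compatible
with units; on unit elements the abstract 2-cell thus becomes an explicit restriction map. -/
theorem ind_map₂_indUnit {F G : C ⟶ D} (σ : F ⟶ G) (P : (Ind.{v, u} κ).obj C) {Y : C}
    (p : P.obj.obj (op Y)) :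
    (((Ind.{v, u} κ).map₂ σ).toNatTrans.app P).hom.app _ (indUnit κ F P p) =
      (((Ind.{v, u} κ).map G).toFunctor.obj P).obj.map (σ.toNatTrans.app Y).op
        (indUnit κ G P p) := by
  have h := adj_unit_comp_τr (presheafAdj.{v, u}.map₂ σ) P.obj
  have := ConcreteCategory.congr_hom (congr_app h (op Y)) p
  exact this.symm

theorem ind_mapComp_indUnit (F : C ⟶ D) (G : D ⟶ E) (P : (Ind.{v, u} κ).obj C) {Y : C}
    (p : P.obj.obj (op Y)) :
    (((Ind.{v, u} κ).mapComp F G).hom.toNatTrans.app P).hom.app _ (indUnit κ (F ≫ G) P p) =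
      indUnit κ G (((Ind.{v, u} κ).map F).toFunctor.obj P) (indUnit κ F P p) := by
  have h := adj_unit_comp_τr (presheafAdj.{v, u}.mapComp F G).hom P.obj
  have := ConcreteCategory.congr_hom (congr_app h (op Y)) p
  exact this.symm

theorem ind_mapId_indUnit (P : (Ind.{v, u} κ).obj C) {Y : C} (p : P.obj.obj (op Y)) :
    (((Ind.{v, u} κ).mapId C).hom.toNatTrans.app P).hom.app _ (indUnit κ (𝟙 C) P p) = p := by
  have h := adj_unit_comp_τr (presheafAdj.{v, u}.mapId C).hom P.obj
  have := ConcreteCategory.congr_hom (congr_app h (op Y)) p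
  exact this.symm

theorem ind_hom_ext (F : C ⟶ D) (P : (Ind.{v, u} κ).obj C) (Q : (Ind.{v, u} κ).obj D)
    {a b : ((Ind.{v, u} κ).map F).toFunctor.obj P ⟶ Q}
    (h : ∀ (Y : C) (p : P.obj.obj (op Y)),
      a.hom.app _ (indUnit κ F P p) = b.hom.app _ (indUnit κ F P p)) : a = b :=
  ObjectProperty.hom_ext _ (lan_hom_ext F.toFunctor P.obj Q.obj h)

theorem exists_ind_desc (F : C ⟶ D) (P : (Ind.{v, u} κ).obj C) (Q : (Ind.{v, u} κ).obj D)
    (g : P.obj ⟶ F.toFunctor.op ⋙ Q.obj) :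
    ∃ a : ((Ind.{v, u} κ).map F).toFunctor.obj P ⟶ Q,
      ∀ (Y : C) (p : P.obj.obj (op Y)), a.hom.app _ (indUnit κ F P p) = g.app _ p := by
  obtain ⟨a, ha⟩ := exists_lan_desc F.toFunctor P.obj Q.obj g
  exact ⟨ObjectProperty.homMk a, ha⟩

end

/-! ### Presentations of presheaves by filtered diagrams -/

/-- Elements `x i` of a presheaf `X` at the values of a diagram `D` exhibiting `X` as the filtered
colimit of the representable presheaves attached to the values of `D`. -/
structure IsPresentation {I : Type u₁} [Category.{v₁} I] {C : Type u₂} [Category.{v₂} C]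
    (D : I ⥤ C) (X : Cᵒᵖ ⥤ Type w) (x : ∀ i, X.obj (op (D.obj i))) : Prop where
  map_eq {i j : I} (f : i ⟶ j) : X.map (D.map f).op (x j) = x i
  exists_rep {c : C} (y : X.obj (op c)) : ∃ (i : I) (a : c ⟶ D.obj i), X.map a.op (x i) = y
  exists_eq {c : C} {i : I} (a b : c ⟶ D.obj i) (h : X.map a.op (x i) = X.map b.op (x i)) :
    ∃ (j : I) (f : i ⟶ j), a ≫ D.map f = b ≫ D.map f

namespace IsPresentation

variable {I : Type u₁} [Category.{v₁} I] {C : Type u₂} [Category.{v₂} C]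
  {D : I ⥤ C} {X : Cᵒᵖ ⥤ Type w} {x : ∀ i, X.obj (op (D.obj i))}

theorem hom_ext (h : IsPresentation D X x) {Y : Cᵒᵖ ⥤ Type w} {f g : X ⟶ Y}
    (hfg : ∀ i, f.app _ (x i) = g.app _ (x i)) : f = g := by
  refine NatTrans.ext (funext fun c => ConcreteCategory.hom_ext _ _ fun y => ?_)
  obtain ⟨i, a, rfl⟩ := h.exists_rep (c := c.unop) y
  rw [NatTrans.naturality_apply, NatTrans.naturality_apply, hfg]

theorem exists_eq' [IsFiltered I] (h : IsPresentation D X x) {c : C} {i j : I}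
    (a : c ⟶ D.obj i) (b : c ⟶ D.obj j) (hab : X.map a.op (x i) = X.map b.op (x j)) :
    ∃ (k : I) (f : i ⟶ k) (g : j ⟶ k), a ≫ D.map f = b ≫ D.map g := by
  obtain ⟨k, f, hf⟩ := h.exists_eq (a ≫ D.map (IsFiltered.leftToMax i j))
    (b ≫ D.map (IsFiltered.rightToMax i j)) (by simp [h.map_eq, hab])
  exact ⟨k, IsFiltered.leftToMax i j ≫ f, IsFiltered.rightToMax i j ≫ f, by simpa using hf⟩

theorem exists_desc [IsFiltered I] (h : IsPresentation D X x) {Y : Cᵒᵖ ⥤ Type w}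
    (y : ∀ i, Y.obj (op (D.obj i))) (hy : ∀ {i j : I} (f : i ⟶ j), Y.map (D.map f).op (y j) = y i) :
    ∃ g : X ⟶ Y, ∀ i, g.app _ (x i) = y i := by
  choose r a hr using fun (c : C) (z : X.obj (op c)) => h.exists_rep z
  have key {c : C} {i j : I} (a : c ⟶ D.obj i) (b : c ⟶ D.obj j)
      (hab : X.map a.op (x i) = X.map b.op (x j)) : Y.map a.op (y i) = Y.map b.op (y j) := by
    obtain ⟨k, f, g, e⟩ := h.exists_eq' a b hab
    have := congr(Y.map ($e).op (y k))
    simpa [hy] using this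
  refine ⟨{ app := fun c => ↾fun z => Y.map (a c.unop z).op (y _), naturality := ?_ }, fun i => ?_⟩
  · intro c c' f
    ext z
    have := key (a c'.unop (X.map f z)) (f.unop ≫ a c.unop z) (by simp [hr])
    simpa using this
  · have := key (a _ (x i)) (𝟙 _) (by simp [hr])
    simpa using this

theorem isIso [IsFiltered I] (h : IsPresentation D X x) {Y : Cᵒᵖ ⥤ Type w}
    {y : ∀ i, Y.obj (op (D.obj i))} (hY : IsPresentation D Y y) (g : X ⟶ Y)
    (hg : ∀ i, g.app _ (x i) = y i) : IsIso g := by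
  obtain ⟨g', hg'⟩ := hY.exists_desc x h.map_eq
  exact ⟨g', h.hom_ext fun i => by simp [hg, hg'], hY.hom_ext fun i => by simp [hg, hg']⟩

theorem of_iso (h : IsPresentation D X x) {Y : Cᵒᵖ ⥤ Type w} (e : X ≅ Y) :
    IsPresentation D Y (fun i => e.hom.app _ (x i)) where
  map_eq f := by rw [← NatTrans.naturality_apply, h.map_eq]
  exists_rep {c} y := by
    obtain ⟨i, a, ha⟩ := h.exists_rep (e.inv.app _ y)
    exact ⟨i, a, by rw [← NatTrans.naturality_apply, ha]; simp⟩
  exists_eq {c i} a b hab := by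
    refine h.exists_eq a b ?_
    rw [← NatTrans.naturality_apply, ← NatTrans.naturality_apply] at hab
    simpa using congr(e.inv.app _ $hab)

end IsPresentation

/-! ### Presentations, colimits of representables and Kan extension -/

section

variable {C D : Type (max u v)} [Category.{v} C] [Category.{v} D]
  {I : Type v} [SmallCategory I]

/-- The cocone under representable presheaves attached to compatible elements of a presheaf. -/
def coconeOfElements (K : I ⥤ C) (P : Cᵒᵖ ⥤ Type (max u v)) (x : ∀ i, P.obj (op (K.obj i)))
    (hx : ∀ {i j : I} (f : i ⟶ j), P.map (K.map f).op (x j) = x i) :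
    K ⋙ uliftYoneda.{max u v} ⟶ (Functor.const I).obj P where
  app i := uliftYonedaEquiv.symm (x i)
  naturality i j f := by
    have := uliftYonedaEquiv_symm_map.{max u v} (K.map f).op (x j)
    simpa [hx] using this.symm

/-- Colimits of presheaves are pointwise, and the three conditions are the usual description of a
filtered colimit of sets. -/
theorem IsPresentation.of_isColimit [IsFiltered I] {K : I ⥤ C} {P : Cᵒᵖ ⥤ Type (max u v)}
    {ι : K ⋙ uliftYoneda.{max u v} ⟶ (Functor.const I).obj P} (h : IsColimit (Cocone.mk P ι)) :
    IsPresentation K P (fun i => uliftYonedaEquiv (ι.app i)) := by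
  have hx {c : C} {i : I} (a : c ⟶ K.obj i) :
      P.map a.op (uliftYonedaEquiv (ι.app i)) = (ι.app i).app (op c) (ULift.up a) := by
    have := uliftYonedaEquiv_naturality (X := op (K.obj i)) (Y := op c) (ι.app i) a.op
    refine this.trans ((uliftYonedaEquiv_comp (uliftYoneda.{max u v}.map a) (ι.app i)).trans ?_)
    exact congrArg _ (uliftYonedaEquiv_uliftYoneda_map a)
  refine ⟨fun {i j} f => ?_, fun {c} y => ?_, fun {c i} a b hab => ?_⟩
  · have := uliftYonedaEquiv_naturality (X := op (K.obj j)) (Y := op (K.obj i)) (ι.app j)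
      (K.map f).op
    refine this.trans ?_
    exact congrArg _ (by simpa using ι.naturality f)
  · have hc := isColimitOfPreserves ((evaluation _ _).obj (op c)) h
    obtain ⟨i, a, ha⟩ := Types.jointly_surjective_of_isColimit hc y
    exact ⟨i, a.down, (hx _).trans ha⟩
  · have hc := isColimitOfPreserves ((evaluation _ _).obj (op c)) h
    rw [hx, hx] at hab
    obtain ⟨j, f, hf⟩ := (Types.FilteredColimit.isColimit_eq_iff' hc (ULift.up a) (ULift.up b)).1 hab
    exact ⟨j, f, congrArg ULift.down hf⟩

/-- A criterion for a presheaf to be a colimit of representable presheaves, by its universal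
property on elements. -/
theorem nonempty_isColimit_coconeOfElements (K : I ⥤ C) (P : Cᵒᵖ ⥤ Type (max u v))
    (x : ∀ i, P.obj (op (K.obj i)))
    (hx : ∀ {i j : I} (f : i ⟶ j), P.map (K.map f).op (x j) = x i)
    (hom_ext : ∀ (Y : Cᵒᵖ ⥤ Type (max u v)) (f g : P ⟶ Y),
      (∀ i, f.app _ (x i) = g.app _ (x i)) → f = g)
    (desc : ∀ (Y : Cᵒᵖ ⥤ Type (max u v)) (y : ∀ i, Y.obj (op (K.obj i))),
      (∀ {i j : I} (f : i ⟶ j), Y.map (K.map f).op (y j) = y i) →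
        ∃ g : P ⟶ Y, ∀ i, g.app _ (x i) = y i) :
    Nonempty (IsColimit (Cocone.mk P (coconeOfElements.{v, u} K P x hx))) := by
  have hd (s : Cocone (K ⋙ uliftYoneda.{max u v})) :=
    desc s.pt (fun i => uliftYonedaEquiv (s.ι.app i)) fun {i j} f => by
      have := uliftYonedaEquiv_naturality (X := op (K.obj j)) (Y := op (K.obj i)) (s.ι.app j)
        (K.map f).op
      refine this.trans ?_
      exact congrArg _ (by simpa using s.ι.naturality f)
  choose d hd using hd
  exact ⟨{
    desc := d
    fac := fun s i => by
      refine uliftYonedaEquiv.injective ?_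
      have := uliftYonedaEquiv_comp (uliftYonedaEquiv.symm (x i)) (d s)
      refine this.trans ?_
      rw [Equiv.apply_symm_apply, hd]
    uniq := fun s m hm => hom_ext _ _ _ fun i => by
      rw [hd, ← hm]
      refine Eq.trans ?_ (uliftYonedaEquiv_comp (uliftYonedaEquiv.symm (x i)) m).symm
      rw [Equiv.apply_symm_apply] }⟩

theorem IsIndObj.exists_isPresentation {κ : Cardinal.{v}} [Fact κ.IsRegular]
    {P : Cᵒᵖ ⥤ Type (max u v)} (hP : IsIndObj.{v, u} κ P) :
    ∃ (I : Type v) (_ : SmallCategory I) (_ : IsCardinalFiltered I κ) (K : I ⥤ C)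
      (x : ∀ i, P.obj (op (K.obj i))), IsPresentation K P x := by
  obtain ⟨I, _, hI, K, ι, ⟨h⟩⟩ := hP
  have := isFiltered_of_isCardinalFiltered I κ
  exact ⟨I, _, hI, K, _, .of_isColimit.{v, u} h⟩

theorem IsPresentation.isIndObj {κ : Cardinal.{v}} [Fact κ.IsRegular] [IsCardinalFiltered I κ]
    {K : I ⥤ C} {P : Cᵒᵖ ⥤ Type (max u v)} {x : ∀ i, P.obj (op (K.obj i))}
    (h : IsPresentation K P x) : IsIndObj.{v, u} κ P := by
  have := isFiltered_of_isCardinalFiltered I κ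
  exact ⟨I, inferInstance, inferInstance, K, _, nonempty_isColimit_coconeOfElements.{v, u} K P x
    h.map_eq (fun _ _ _ => h.hom_ext) (fun _ => h.exists_desc)⟩

/-- By adjunction, maps out of the Kan extension are maps out of `P` into a restriction, hence
compatible families of elements at the `K ⋙ F` values. This is the universal property of the
colimit, from which the elementwise conditions are read off. -/
theorem IsPresentation.lan [IsFiltered I] {K : I ⥤ C} {P : Cᵒᵖ ⥤ Type (max u v)}
    {x : ∀ i, P.obj (op (K.obj i))} (h : IsPresentation K P x) (F : C ⥤ D) :
    IsPresentation (K ⋙ F) (F.op.lan.obj P)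
      (fun i => (F.op.lanUnit.app P).app (op (K.obj i)) (x i)) := by
  have nat {Y Y' : C} (f : Y' ⟶ Y) (p : P.obj (op Y)) :
      (F.op.lan.obj P).map (F.map f).op ((F.op.lanUnit.app P).app (op Y) p) =
        (F.op.lanUnit.app P).app (op Y') (P.map f.op p) :=
    (NatTrans.naturality_apply (F.op.lanUnit.app P) f.op p).symm
  have hom_ext (Q : Dᵒᵖ ⥤ Type (max u v)) (a b : F.op.lan.obj P ⟶ Q)
      (hab : ∀ i, a.app _ ((F.op.lanUnit.app P).app (op (K.obj i)) (x i)) =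
        b.app _ ((F.op.lanUnit.app P).app (op (K.obj i)) (x i))) : a = b := by
    refine lan_hom_ext.{v, u} F P Q fun Y p => ?_
    obtain ⟨i, a, rfl⟩ := h.exists_rep p
    rw [← nat, NatTrans.naturality_apply, NatTrans.naturality_apply]
    exact congrArg _ (hab i)
  obtain ⟨hc⟩ := nonempty_isColimit_coconeOfElements.{v, u} (K ⋙ F) (F.op.lan.obj P)
    (fun i => (F.op.lanUnit.app P).app (op (K.obj i)) (x i))
    (fun f => (nat _ _).trans (by rw [h.map_eq])) hom_ext (fun Q y hy => by
      obtain ⟨g, hg⟩ := h.exists_desc (Y := F.op ⋙ Q) y hy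
      obtain ⟨a, ha⟩ := exists_lan_desc.{v, u} F P Q g
      exact ⟨a, fun i => (ha _ _).trans (hg i)⟩)
  have := IsPresentation.of_isColimit.{v, u} hc
  convert! this using 2 with i
  exact (Equiv.apply_symm_apply _ _).symm

end

/-! ### Presheaves on the terms of a diagram of categories -/

theorem presheaf_map_comp_apply {C : Type u₁} [Category.{v₁} C] (X : Cᵒᵖ ⥤ Type w) {a b c : C}
    (f : a ⟶ b) (g : b ⟶ c) (y : X.obj (op c)) :
    X.map (f ≫ g).op y = X.map f.op (X.map g.op y) := by
  simp

theorem PseudoLimit.comp_app {J : Type u₁} [Category.{v₁} J]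
    {F : LocallyDiscrete J ⥤ᵖ Cat.{v, u}} {X Y Z : PseudoLimit F} (f : X ⟶ Y) (g : Y ⟶ Z) (j : J) :
    PseudoLimit.Hom.app (f ≫ g) j = f.app j ≫ g.app j :=
  rfl

section PresheafSystem

variable {J : Type u₁} [Category.{v₁} J]

/-- A family of presheaves on the terms of a diagram of categories, with coherent transition
maps: equivalently, a lax cone over the diagram of presheaf categories. -/
structure PresheafSystem (F : LocallyDiscrete J ⥤ᵖ Cat.{v, u}) where
  /-- The presheaves. -/
  obj (j : J) : (F.obj ⟨j⟩)ᵒᵖ ⥤ Type w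
  /-- The transition maps. -/
  tr {i j : J} (f : i ⟶ j) {c : F.obj ⟨i⟩} (y : (obj i).obj (op c)) :
    (obj j).obj (op ((F.map f.toLoc).toFunctor.obj c))
  tr_map {i j : J} (f : i ⟶ j) {c c' : F.obj ⟨i⟩} (g : c' ⟶ c) (y : (obj i).obj (op c)) :
    tr f ((obj i).map g.op y) = (obj j).map ((F.map f.toLoc).toFunctor.map g).op (tr f y)
  tr_id {j : J} {c : F.obj ⟨j⟩} (y : (obj j).obj (op c)) :
    tr (𝟙 j) y = (obj j).map ((F.mapId ⟨j⟩).hom.toNatTrans.app c).op y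
  tr_comp {i j k : J} (f : i ⟶ j) (g : j ⟶ k) {c : F.obj ⟨i⟩} (y : (obj i).obj (op c)) :
    tr (f ≫ g) y =
      (obj k).map ((F.mapComp f.toLoc g.toLoc).hom.toNatTrans.app c).op (tr g (tr f y))

namespace PresheafSystem

variable {F : LocallyDiscrete J ⥤ᵖ Cat.{v, u}} (X : PresheafSystem.{v, u, w} F)

/-- A compatible family of elements of a system of presheaves at an object of the
pseudo-limit. -/
@[ext]
structure Section (Y : PseudoLimit F) where
  /-- The elements. -/
  el (j : J) : (X.obj j).obj (op (Y.obj j))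
  compat {i j : J} (f : i ⟶ j) : X.tr f (el i) = (X.obj j).map (Y.iso f).hom.op (el j)

/-- The presheaf of compatible families of elements on the pseudo-limit. -/
def sections : (PseudoLimit F)ᵒᵖ ⥤ Type (max u₁ w) where
  obj Y := X.Section Y.unop
  map {Y Y'} a := ↾fun s =>
    { el := fun j => (X.obj j).map (a.unop.app j).op (s.el j)
      compat := fun {i j} f => by
        rw [X.tr_map, s.compat, ← ConcreteCategory.comp_apply, ← ConcreteCategory.comp_apply,
          ← Functor.map_comp, ← Functor.map_comp, ← op_comp, ← op_comp, a.unop.naturality] }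
  map_id Y := by
    refine ConcreteCategory.hom_ext _ _ fun s => ?_
    refine Section.ext (funext fun j => ?_)
    exact ConcreteCategory.congr_hom ((X.obj j).map_id _) (s.el j)
  map_comp a b := by
    refine ConcreteCategory.hom_ext _ _ fun s => ?_
    refine Section.ext (funext fun j => ?_)
    exact ConcreteCategory.congr_hom ((X.obj j).map_comp _ _) (s.el j)

theorem sections_map_el {Y Y' : PseudoLimit F} (a : Y' ⟶ Y) (s : X.sections.obj (op Y)) (j : J) :
    Section.el (X.sections.map a.op s) j = (X.obj j).map (a.app j).op (Section.el s j) :=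
  rfl

/-- Commutation of `κ`-small limits with `κ`-filtered colimits: choices and equations made
separately at each object or arrow of `J` hold simultaneously at a later stage. -/
theorem sections_isPresentation {κ : Cardinal.{w₁}} [Fact κ.IsRegular]
    (hJ : HasCardinalLT (Arrow J) κ) {I : Type u₂} [Category.{v₂} I] [IsCardinalFiltered I κ]
    (D : I ⥤ PseudoLimit F) (x : ∀ i, X.sections.obj (op (D.obj i)))
    (h : ∀ j, IsPresentation (D ⋙ PseudoLimit.proj F j) (X.obj j)
      (fun i => Section.el (x i) j)) :
    IsPresentation D X.sections x where
  map_eq f := Section.ext (funext fun j => (h j).map_eq f)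
  exists_rep {Y} y := by
    have hJ' : HasCardinalLT J κ := hasCardinalLT_of_hasCardinalLT_arrow hJ
    have map_eq {i i' : I} (f : i ⟶ i') (j : J) :
        (X.obj j).map ((D.map f).app j).op (Section.el (x i') j) = Section.el (x i) j :=
      (h j).map_eq f
    obtain ⟨i₀, b, hb⟩ : ∃ (i₀ : I) (b : ∀ j, Y.obj j ⟶ (D.obj i₀).obj j),
        ∀ j, (X.obj j).map (b j).op (Section.el (x i₀) j) = Section.el y j := by
      have rep (j : J) : ∃ (i : I) (a : Y.obj j ⟶ (D.obj i).obj j),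
        (X.obj j).map a.op (Section.el (x i) j) = Section.el y j := (h j).exists_rep _
      choose i a ha using rep
      refine ⟨IsCardinalFiltered.max i hJ', fun j => a j ≫
        (D.map (IsCardinalFiltered.toMax i hJ' j)).app j, fun j => ?_⟩
      rw [presheaf_map_comp_apply, map_eq, ha]
    -- Both sides of the naturality square of `b` pull the section at `i₀` back to the same element,
    -- as `x i₀` and `y` are compatible families; so they agree at a later stage depending on `f`.
    have hk (f : Arrow J) : ∃ (k : I) (g : i₀ ⟶ k),
        ((F.map f.hom.toLoc).toFunctor.map (b f.left) ≫ ((D.obj i₀).iso f.hom).hom) ≫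
          (D.map g).app f.right = ((Y.iso f.hom).hom ≫ b f.right) ≫ (D.map g).app f.right := by
      refine (h f.right).exists_eq _ _ ?_
      refine (presheaf_map_comp_apply (X.obj f.right) _ _ _).trans (Eq.trans ?_
        (presheaf_map_comp_apply (X.obj f.right) _ _ _).symm)
      refine (congrArg _ (Section.compat (x i₀) f.hom).symm).trans (Eq.trans ?_
        (congrArg _ (hb f.right).symm))
      refine (X.tr_map f.hom _ _).symm.trans ((congrArg _ (hb f.left)).trans ?_)
      exact Section.compat y f.hom
    choose k g hg using hk
    obtain ⟨m, p, q, hpq⟩ := IsCardinalFiltered.wideSpan g hJ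
    refine ⟨m, { app := fun j => b j ≫ (D.map q).app j, naturality := fun {i j} f => ?_ },
      Section.ext (funext fun j => ?_)⟩
    · have := congr($(hg (Arrow.mk f)) ≫ (D.map (p (Arrow.mk f))).app j)
      dsimp at this
      rw [Functor.map_comp, Category.assoc, (D.map q).naturality, ← hpq (Arrow.mk f),
        Functor.map_comp, PseudoLimit.comp_app]
      simpa only [Category.assoc] using this
    · rw [sections_map_el]
      dsimp only
      rw [presheaf_map_comp_apply, map_eq, hb]
  exists_eq {Y i} a b hab := by
    have hJ' : HasCardinalLT J κ := hasCardinalLT_of_hasCardinalLT_arrow hJ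
    have hk (j : J) : ∃ (k : I) (g : i ⟶ k), a.app j ≫ (D.map g).app j =
        b.app j ≫ (D.map g).app j :=
      (h j).exists_eq (a.app j) (b.app j) congr(Section.el $hab j)
    choose k g hg using hk
    obtain ⟨m, p, q, hpq⟩ := IsCardinalFiltered.wideSpan g hJ'
    refine ⟨m, q, PseudoLimit.Hom.ext (funext fun j => ?_)⟩
    have := congr($(hg j) ≫ (D.map (p j)).app j)
    rw [Category.assoc, Category.assoc] at this
    rw [← hpq j, Functor.map_comp]
    exact this

end PresheafSystem

end PresheafSystem

/-! ### Categories of elements and lifting of cocones -/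

/-- An object of the category of elements of a presheaf. -/
structure El {C : Type u₁} [Category.{v₁} C] (X : Cᵒᵖ ⥤ Type w) where
  /-- The underlying object. -/
  pt : C
  /-- The element. -/
  el : X.obj (op pt)

namespace El

variable {C : Type u₁} [Category.{v₁} C] {X : Cᵒᵖ ⥤ Type w}

/-- A morphism in the category of elements of a presheaf. -/
@[ext]
structure Hom (p q : El X) where
  /-- The underlying morphism. -/
  hom : p.pt ⟶ q.pt
  map_el : X.map hom.op q.el = p.el

instance : Category (El X) where
  Hom p q := Hom p q
  id p := ⟨𝟙 _, by simp⟩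
  comp f g := ⟨f.hom ≫ g.hom, by simp [f.map_el, g.map_el]⟩
  id_comp _ := Hom.ext (Category.id_comp _)
  comp_id _ := Hom.ext (Category.comp_id _)
  assoc _ _ _ := Hom.ext (Category.assoc _ _ _)

/-- The forgetful functor of the category of elements. -/
def forget (X : Cᵒᵖ ⥤ Type w) : El X ⥤ C where
  obj p := p.pt
  map f := f.hom
  map_id _ := rfl
  map_comp _ _ := rfl

end El

/-- The prescribed cocone in the base and the diagram upstairs both factor through a single `D i`,
compatibly. The cartesian lift of `t : b ⟶ P (D i)` is then the point of the lifted cocone, and its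
universal property supplies the legs. The element at the point is the restriction of `x i`. -/
theorem IsStreetFibration.exists_lift_cocone {E : Type u₁} [Category.{v₁} E] {B : Type u₂}
    [Category.{v₂} B] {P : E ⥤ B} (hP : IsStreetFibration P) {X : Eᵒᵖ ⥤ Type w₁}
    {Y : Bᵒᵖ ⥤ Type w₂} (θ : ∀ {e : E}, X.obj (op e) → Y.obj (op (P.obj e)))
    (θ_map : ∀ {e e' : E} (f : e' ⟶ e) (z : X.obj (op e)),
      θ (X.map f.op z) = Y.map (P.map f).op (θ z))
    {κ : Cardinal.{w}} [Fact κ.IsRegular] {I : Type u₃} [Category.{v₃} I] [IsCardinalFiltered I κ]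
    {D : I ⥤ E} {x : ∀ i, X.obj (op (D.obj i))} (hX : IsPresentation D X x)
    (hY : IsPresentation (D ⋙ P) Y (fun i => θ (x i)))
    {A : Type w₃} [Category.{x} A] (hA : HasCardinalLT (Arrow A) κ) (d : A ⥤ El X)
    (b : B) (y : Y.obj (op b)) (leg : ∀ a, P.obj (d.obj a).pt ⟶ b)
    (leg_nat : ∀ {a a' : A} (f : a ⟶ a'), P.map (d.map f).hom ≫ leg a' = leg a)
    (leg_el : ∀ a, Y.map (leg a).op y = θ (d.obj a).el) :
    ∃ (e : E) (z : X.obj (op e)) (h : P.obj e ≅ b) (l : ∀ a, (d.obj a).pt ⟶ e),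
      (∀ {a a' : A} (f : a ⟶ a'), (d.map f).hom ≫ l a' = l a) ∧
      (∀ a, X.map (l a).op z = (d.obj a).el) ∧ θ z = Y.map h.hom.op y ∧
      ∀ a, P.map (l a) ≫ h.hom = leg a := by
  have := isFiltered_of_isCardinalFiltered I κ
  have hA' : HasCardinalLT A κ := hasCardinalLT_of_hasCardinalLT_arrow hA
  -- a stage of the diagram through which all the elements factor
  obtain ⟨i, u, t, hu, ht⟩ : ∃ (i : I) (u : ∀ a, (d.obj a).pt ⟶ D.obj i) (t : b ⟶ P.obj (D.obj i)),
      (∀ a, X.map (u a).op (x i) = (d.obj a).el) ∧ Y.map t.op (θ (x i)) = y := by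
    choose i u hu using fun a => hX.exists_rep (d.obj a).el
    obtain ⟨k, t, ht⟩ := hY.exists_rep y
    let m := IsCardinalFiltered.max i hA'
    refine ⟨IsFiltered.max m k, fun a => u a ≫ D.map (IsCardinalFiltered.toMax i hA' a ≫
      IsFiltered.leftToMax m k), t ≫ P.map (D.map (IsFiltered.rightToMax m k)), fun a => ?_, ?_⟩
    · rw [op_comp, Functor.map_comp, ConcreteCategory.comp_apply, hX.map_eq, hu]
    · rw [op_comp, Functor.map_comp, ConcreteCategory.comp_apply, ← θ_map, hX.map_eq, ← ht]
  -- a later stage where the factorizations are compatible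
  obtain ⟨i, u, t, hu, ht, u_nat⟩ : ∃ (i : I) (u : ∀ a, (d.obj a).pt ⟶ D.obj i)
      (t : b ⟶ P.obj (D.obj i)), (∀ a, X.map (u a).op (x i) = (d.obj a).el) ∧
        Y.map t.op (θ (x i)) = y ∧ ∀ {a a' : A} (f : a ⟶ a'), (d.map f).hom ≫ u a' = u a := by
    choose k g hg using fun f : Arrow A => hX.exists_eq ((d.map f.hom).hom ≫ u f.right)
      (u f.left) (by
        rw [op_comp, Functor.map_comp, ConcreteCategory.comp_apply, hu, hu]
        exact (d.map f.hom).map_el)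
    obtain ⟨m, p, q, hpq⟩ := IsCardinalFiltered.wideSpan g hA
    refine ⟨m, fun a => u a ≫ D.map q, t ≫ P.map (D.map q), fun a => ?_, ?_, fun {a a'} f => ?_⟩
    · rw [op_comp, Functor.map_comp, ConcreteCategory.comp_apply, hX.map_eq, hu]
    · rw [op_comp, Functor.map_comp, ConcreteCategory.comp_apply, ← θ_map, hX.map_eq, ht]
    · have := congr($(hg (Arrow.mk f)) ≫ D.map (p (Arrow.mk f)))
      rw [← hpq (Arrow.mk f), Functor.map_comp]
      simpa using this
  -- `P (u a)` and `leg a ≫ t` pull `θ (x i)` back to the same element of `Y`, so a still later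
  -- stage makes them equal for all `a`.
  obtain ⟨i, u, t, hu, ht, u_nat, hut⟩ : ∃ (i : I) (u : ∀ a, (d.obj a).pt ⟶ D.obj i)
      (t : b ⟶ P.obj (D.obj i)), (∀ a, X.map (u a).op (x i) = (d.obj a).el) ∧
        Y.map t.op (θ (x i)) = y ∧ (∀ {a a' : A} (f : a ⟶ a'), (d.map f).hom ≫ u a' = u a) ∧
        ∀ a, P.map (u a) = leg a ≫ t := by
    choose k g hg using fun a : A => hY.exists_eq (P.map (u a)) (leg a ≫ t) (by
        rw [op_comp, Functor.map_comp, ConcreteCategory.comp_apply, ht, leg_el, ← θ_map, hu])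
    obtain ⟨m, p, q, hpq⟩ := IsCardinalFiltered.wideSpan g hA'
    refine ⟨m, fun a => u a ≫ D.map q, t ≫ P.map (D.map q), fun a => ?_, ?_, fun {a a'} f => ?_,
      fun a => ?_⟩
    · rw [op_comp, Functor.map_comp, ConcreteCategory.comp_apply, hX.map_eq, hu]
    · rw [op_comp, Functor.map_comp, ConcreteCategory.comp_apply, ← θ_map, hX.map_eq, ht]
    · rw [← Category.assoc, u_nat]
    · have := congr($(hg a) ≫ P.map (D.map (p a)))
      rw [← hpq a, Functor.map_comp]
      simpa using this
  obtain ⟨e, φ, h, hφ, hc⟩ := hP (D.obj i) b t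
  have hl (a : A) : ∃! l : (d.obj a).pt ⟶ e, P.IsHomLift (leg a ≫ h.inv) l ∧ l ≫ φ = u a := by
    have : P.IsHomLift ((leg a ≫ h.inv) ≫ P.map φ) (u a) := by
      have e : (leg a ≫ h.inv) ≫ P.map φ = P.map (u a) := by simp [hφ, hut]
      rw [e]
      infer_instance
    exact hc.universal_property' _ _
  choose l hl hl' using hl
  have hPl (a : A) : P.map (l a) = leg a ≫ h.inv := by
    have := (hl a).1
    simpa using IsHomLift.fac' P (leg a ≫ h.inv) (l a)
  -- Legs commute with the diagram by uniqueness of lifts through the cartesian arrow `φ`.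
  refine ⟨e, X.map φ.op (x i), h, l, fun {a a'} f => hl' a _ ⟨?_, ?_⟩, fun a => ?_, ?_, fun a => ?_⟩
  · have e : leg a ≫ h.inv = P.map ((d.map f).hom ≫ l a') := by
      rw [P.map_comp, hPl, ← Category.assoc, leg_nat]
    rw [e]
    infer_instance
  · rw [Category.assoc, (hl a').2, u_nat]
  · rw [← ConcreteCategory.comp_apply, ← Functor.map_comp, ← op_comp, (hl a).2, hu]
  · rw [θ_map, hφ, op_comp, Functor.map_comp, ConcreteCategory.comp_apply, ht]
  · rw [hPl, Category.assoc, h.inv_hom_id, Category.comp_id]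

/-! ### Restriction of systems of presheaves -/

section Reindex

variable {J : Type u₁} [Category.{v₁} J] {F : LocallyDiscrete J ⥤ᵖ Cat.{v, u}}

/-- The composite is a variable `fg` because after reindexing along `K` the arrows `K.map (f ≫ g)`
and `K.map f ≫ K.map g` are only propositionally equal. -/
theorem PseudoLimit.iso_comp' (Y : PseudoLimit F) {i j k : J} (f : i ⟶ j) (g : j ⟶ k)
    (fg : i ⟶ k) (h : f ≫ g = fg) :
    (Y.iso fg).hom = (F.mapComp' f.toLoc g.toLoc fg.toLoc (by rw [← h]; rfl)).hom.toNatTrans.app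
      (Y.obj i) ≫ (F.map g.toLoc).toFunctor.map (Y.iso f).hom ≫ (Y.iso g).hom := by
  subst h
  rw [Y.iso_comp, ← F.mapComp'_eq_mapComp]
  rfl

theorem PresheafSystem.tr_comp' (X : PresheafSystem.{v, u, w} F) {i j k : J} (f : i ⟶ j)
    (g : j ⟶ k) (fg : i ⟶ k) (h : f ≫ g = fg) {c : F.obj ⟨i⟩} (y : (X.obj i).obj (op c)) :
    X.tr fg y = (X.obj k).map ((F.mapComp' f.toLoc g.toLoc fg.toLoc
      (by rw [← h]; rfl)).hom.toNatTrans.app c).op (X.tr g (X.tr f y)) := by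
  subst h
  rw [X.tr_comp, ← F.mapComp'_eq_mapComp]
  rfl

/-- The isomorphism of the value of a pseudofunctor at an endomorphism equal to the identity with
the identity. -/
def mapIdIso (F : LocallyDiscrete J ⥤ᵖ Cat.{v, u}) {j : J} (f : j ⟶ j) (h : f = 𝟙 j) :
    F.map f.toLoc ≅ 𝟙 (F.obj ⟨j⟩) :=
  F.map₂Iso (eqToIso (by rw [h]; rfl)) ≪≫ F.mapId ⟨j⟩

theorem mapIdIso_id (j : J) : mapIdIso F (𝟙 j) rfl = F.mapId ⟨j⟩ := by
  ext1
  change F.map₂ (𝟙 _) ≫ _ = _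
  rw [F.map₂_id]
  exact Category.id_comp _

theorem PseudoLimit.iso_id' (Y : PseudoLimit F) {j : J} (f : j ⟶ j) (h : f = 𝟙 j) :
    (Y.iso f).hom = (mapIdIso F f h).hom.toNatTrans.app (Y.obj j) := by
  subst h
  rw [Y.iso_id, mapIdIso_id]

theorem PresheafSystem.tr_id' (X : PresheafSystem.{v, u, w} F) {j : J} (f : j ⟶ j) (h : f = 𝟙 j)
    {c : F.obj ⟨j⟩} (y : (X.obj j).obj (op c)) :
    X.tr f y = (X.obj j).map ((mapIdIso F f h).hom.toNatTrans.app c).op y := by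
  subst h
  rw [X.tr_id, mapIdIso_id]
  rfl

variable {J' : Type u₂} [Category.{v₂} J'] (K : J' ⥤ J)

/-- The restriction of objects of a pseudo-limit along a change of diagram. -/
def PseudoLimit.restrict : PseudoLimit F ⥤ PseudoLimit (K.toPseudofunctor.comp F) where
  obj Y :=
    { obj := fun j => Y.obj (K.obj j)
      iso := fun f => Y.iso (K.map f)
      iso_id := fun j => Y.iso_id' _ (K.map_id j)
      iso_comp := fun f g => Y.iso_comp' _ _ _ (K.map_comp f g).symm }
  map a :=
    { app := fun j => a.app (K.obj j)
      naturality := fun f => a.naturality (K.map f) }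
  map_id _ := rfl
  map_comp _ _ := rfl

/-- The restriction of a system of presheaves along a change of diagram. -/
def PresheafSystem.restrict (X : PresheafSystem.{v, u, w} F) :
    PresheafSystem.{v, u, w} (K.toPseudofunctor.comp F) where
  obj j := X.obj (K.obj j)
  tr f _ y := X.tr (K.map f) y
  tr_map f := X.tr_map (K.map f)
  tr_id {j} {_} y := X.tr_id' _ (K.map_id j) y
  tr_comp {_ _ _} f g {_} y := X.tr_comp' _ _ _ (K.map_comp f g).symm y

/-- The restriction of pairs of an object of a pseudo-limit and a compatible family of elements
along a change of diagram. -/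
def PresheafSystem.restrictEl (X : PresheafSystem.{v, u, w} F) :
    El X.sections ⥤ El (X.restrict K).sections where
  obj p := ⟨(PseudoLimit.restrict K).obj p.pt,
    { el := fun j => Section.el p.el (K.obj j)
      compat := fun f => Section.compat p.el (K.map f) }⟩
  map a := ⟨(PseudoLimit.restrict K).map a.hom,
    Section.ext (funext fun j => congr(Section.el $(a.map_el) (K.obj j)))⟩
  map_id _ := rfl
  map_comp _ _ := rfl

end Reindex

/-! ### Componentwise construction of cocones in the pseudo-limit -/

section Link

variable {J : Type u₁} [Category.{v₁} J] {F : LocallyDiscrete J ⥤ᵖ Cat.{v, u}}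
  {X : PresheafSystem.{v, u, w} F} {A : Type w₁} [Category.{w₂} A] (d : A ⥤ El X.sections)

/-- A cocone, with an element at its point, over one component of a diagram of pairs of an object
of the pseudo-limit and a compatible family of elements. -/
structure CoconeAt (j : J) where
  /-- The point. -/
  pt : F.obj ⟨j⟩
  /-- The element. -/
  el : (X.obj j).obj (op pt)
  /-- The legs. -/
  leg (a : A) : (d.obj a).pt.obj j ⟶ pt
  leg_nat {a a' : A} (f : a ⟶ a') : (d.map f).hom.app j ≫ leg a' = leg a
  leg_el (a : A) : (X.obj j).map (leg a).op el = PresheafSystem.Section.el (d.obj a).el j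

variable {d}

/-- A transition isomorphism between cocones over two components. -/
structure Link {i j : J} (f : i ⟶ j) (z : CoconeAt d i) (z' : CoconeAt d j) where
  /-- The isomorphism. -/
  iso : (F.map f.toLoc).toFunctor.obj z.pt ≅ z'.pt
  tr_el : X.tr f z.el = (X.obj j).map iso.hom.op z'.el
  map_leg (a : A) : (F.map f.toLoc).toFunctor.map (z.leg a) ≫ iso.hom =
    ((d.obj a).pt.iso f).hom ≫ z'.leg a

namespace Link

/-- The coherence of three transition isomorphisms. -/
def Coh {i j k : J} {f : i ⟶ j} {g : j ⟶ k} {fg : i ⟶ k} (h : f ≫ g = fg) {z : CoconeAt d i}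
    {z' : CoconeAt d j} {z'' : CoconeAt d k} (l : Link f z z') (m : Link g z' z'')
    (n : Link fg z z'') : Prop :=
  n.iso.hom = (F.mapComp' f.toLoc g.toLoc fg.toLoc (by rw [← h]; rfl)).hom.toNatTrans.app z.pt ≫
    (F.map g.toLoc).toFunctor.map l.iso.hom ≫ m.iso.hom

/-- The identity transition isomorphism. -/
def refl {j : J} (f : j ⟶ j) (h : f = 𝟙 j) (z : CoconeAt d j) : Link f z z where
  iso := (Cat.Hom.toNatIso (mapIdIso F f h)).app z.pt
  tr_el := X.tr_id' f h z.el
  map_leg a := by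
    rw [(d.obj a).pt.iso_id' f h]
    exact (mapIdIso F f h).hom.toNatTrans.naturality (z.leg a)

theorem coh_refl_left {j k : J} {f : j ⟶ j} (h : f = 𝟙 j) {g : j ⟶ k} (h' : f ≫ g = g)
    {z : CoconeAt d j} {z' : CoconeAt d k} (l : Link g z z') : Coh h' (refl f h z) l l := by
  subst h
  have e : (F.mapComp' (𝟙 _) g.toLoc g.toLoc).hom.toNatTrans.app z.pt ≫
      (F.map g.toLoc).toFunctor.map ((F.mapId ⟨j⟩).hom.toNatTrans.app z.pt) = 𝟙 _ := by
    rw [F.mapComp'_id_comp_hom]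
    simp [← Functor.map_comp]
  rw [← mapIdIso_id] at e
  exact ((Category.assoc _ _ _).symm.trans
    ((congrArg (· ≫ l.iso.hom) e).trans (Category.id_comp _))).symm

theorem coh_refl_right {j k : J} {g : k ⟶ k} (h : g = 𝟙 k) {f : j ⟶ k} (h' : f ≫ g = f)
    {z : CoconeAt d j} {z' : CoconeAt d k} (l : Link f z z') : Coh h' l (refl g h z') l := by
  subst h
  have e : (F.mapComp' f.toLoc (𝟙 _) f.toLoc).hom.toNatTrans.app z.pt ≫
      (F.mapId ⟨k⟩).hom.toNatTrans.app ((F.map f.toLoc).toFunctor.obj z.pt) = 𝟙 _ := by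
    rw [F.mapComp'_comp_id_hom]
    simp
  have nat := (F.mapId ⟨k⟩).hom.toNatTrans.naturality l.iso.hom
  rw [← mapIdIso_id] at e nat
  refine Eq.symm ((congrArg (_ ≫ ·) nat).trans ?_)
  exact (Category.assoc _ _ _).symm.trans ((congrArg (· ≫ l.iso.hom) e).trans (Category.id_comp _))

end Link

variable (d) in
/-- A coherent family of cocones over the components. -/
structure LinkSystem where
  /-- The cocones. -/
  z (j : J) : CoconeAt d j
  /-- The transition isomorphisms. -/
  link {i j : J} (f : i ⟶ j) : Link f (z i) (z j)
  link_id (j : J) : link (𝟙 j) = .refl (𝟙 j) rfl (z j)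
  coh {i j k : J} (f : i ⟶ j) (g : j ⟶ k) : Link.Coh rfl (link f) (link g) (link (f ≫ g))

namespace LinkSystem

variable (S : LinkSystem d)

/-- The point of the cocone attached to a coherent family of cocones over the components. -/
def toEl : El X.sections where
  pt :=
    { obj := fun j => (S.z j).pt
      iso := fun f => (S.link f).iso
      iso_id := fun j => by
        rw [S.link_id]
        exact congr(($(mapIdIso_id (F := F) j)).hom.toNatTrans.app (S.z j).pt)
      iso_comp := fun f g => by
        refine (S.coh f g).trans ?_
        rw [← F.mapComp'_eq_mapComp]
        rfl }
  el :=
    { el := fun j => (S.z j).el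
      compat := fun f => (S.link f).tr_el }

/-- The legs of the cocone attached to a coherent family of cocones over the components. -/
def leg (a : A) : d.obj a ⟶ S.toEl where
  hom :=
    { app := fun j => (S.z j).leg a
      naturality := fun f => (S.link f).map_leg a }
  map_el := PresheafSystem.Section.ext (funext fun j => (S.z j).leg_el a)

theorem leg_nat {a a' : A} (f : a ⟶ a') : d.map f ≫ S.leg a' = S.leg a :=
  El.Hom.ext (PseudoLimit.Hom.ext (funext fun j => (S.z j).leg_nat f))

/-- A coherent family of cocones is determined by the transition isomorphisms for
non-identity arrows, in a skeletal thin category. -/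
noncomputable def ofNe [Quiver.IsThin J] (hJ : ∀ {i j : J} (_ : i ⟶ j) (_ : j ⟶ i), i = j)
    (z : ∀ j, CoconeAt d j) (l : ∀ {i j : J} (f : i ⟶ j), i ≠ j → Link f (z i) (z j))
    (coh : ∀ {i j k : J} (f : i ⟶ j) (g : j ⟶ k) (hf : i ≠ j) (hg : j ≠ k) (hfg : i ≠ k),
      Link.Coh rfl (l f hf) (l g hg) (l (f ≫ g) hfg)) : LinkSystem d := by
  classical
  let link {i j : J} (f : i ⟶ j) : Link f (z i) (z j) :=
    if h : i = j then by
      subst h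
      exact .refl f (Subsingleton.elim _ _) (z i)
    else l f h
  have link_self {j : J} (f : j ⟶ j) : link f = .refl f (Subsingleton.elim _ _) (z j) :=
    dif_pos rfl
  have link_ne {i j : J} (f : i ⟶ j) (h : i ≠ j) : link f = l f h := dif_neg h
  refine ⟨z, link, fun j => link_self _, fun {i j k} f g => ?_⟩
  by_cases hf : i = j
  · subst hf
    obtain rfl : f = 𝟙 i := Subsingleton.elim _ _
    have (fg : i ⟶ k) (h : 𝟙 i ≫ g = fg) : Link.Coh h (link (𝟙 i)) (link g) (link fg) := by
      obtain rfl : g = fg := Subsingleton.elim _ _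
      rw [link_self]
      exact Link.coh_refl_left rfl _ _
    exact this _ rfl
  by_cases hg : j = k
  · subst hg
    obtain rfl : g = 𝟙 j := Subsingleton.elim _ _
    have (fg : i ⟶ j) (h : f ≫ 𝟙 j = fg) : Link.Coh h (link f) (link (𝟙 j)) (link fg) := by
      obtain rfl : f = fg := Subsingleton.elim _ _
      rw [link_self]
      exact Link.coh_refl_right rfl _ _
    exact this _ rfl
  -- Skeletality excludes a round trip `i ⟶ j ⟶ i` through `j ≠ i`, so the composite is again
  -- covered by `l`.
  have hfg : i ≠ k := by
    rintro rfl
    exact hf (hJ f g)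
  rw [link_ne f hf, link_ne g hg, link_ne _ hfg]
  exact coh f g hf hg hfg

theorem ofNe_link [Quiver.IsThin J] (hJ : ∀ {i j : J} (_ : i ⟶ j) (_ : j ⟶ i), i = j)
    (z : ∀ j, CoconeAt d j) (l : ∀ {i j : J} (f : i ⟶ j), i ≠ j → Link f (z i) (z j))
    (coh : ∀ {i j k : J} (f : i ⟶ j) (g : j ⟶ k) (hf : i ≠ j) (hg : j ≠ k) (hfg : i ≠ k),
      Link.Coh rfl (l f hf) (l g hg) (l (f ≫ g) hfg)) {i j : J} (f : i ⟶ j) (h : i ≠ j) :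
    (ofNe hJ z l coh).link f = l f h :=
  dif_neg h

end LinkSystem

section Restrict

variable {J' : Type u₂} [Category.{v₂} J'] (K : J' ⥤ J)

/-- The restriction of a cocone at a component along a change of diagram. -/
def CoconeAt.restrict {j : J'} (z : CoconeAt d (K.obj j)) :
    CoconeAt (d ⋙ X.restrictEl K) j where
  pt := z.pt
  el := z.el
  leg a := z.leg a
  leg_nat f := z.leg_nat f
  leg_el a := z.leg_el a

/-- The restriction of a transition isomorphism along a change of diagram. -/
def Link.restrict {i j : J'} {f : i ⟶ j} {z : CoconeAt d (K.obj i)} {z' : CoconeAt d (K.obj j)}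
    (l : Link (K.map f) z z') : Link f (z.restrict K) (z'.restrict K) where
  iso := l.iso
  tr_el := l.tr_el
  map_leg a := l.map_leg a

theorem Link.Coh.restrict {i j k : J'} {f : i ⟶ j} {g : j ⟶ k}
    {z : CoconeAt d (K.obj i)} {z' : CoconeAt d (K.obj j)} {z'' : CoconeAt d (K.obj k)}
    {l : Link (K.map f) z z'} {m : Link (K.map g) z' z''} {n : Link (K.map (f ≫ g)) z z''}
    (h : Link.Coh (K.map_comp f g).symm l m n) :
    Link.Coh rfl (l.restrict K) (m.restrict K) (n.restrict K) := by
  have e : (K.toPseudofunctor.comp F).mapComp f.toLoc g.toLoc =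
    (K.toPseudofunctor.comp F).mapComp' f.toLoc g.toLoc (f ≫ g).toLoc rfl :=
      (Pseudofunctor.mapComp'_eq_mapComp _ _ _).symm
  exact Eq.trans h (congrArg (fun t => t.hom.toNatTrans.app z.pt ≫
      (F.map (K.map g).toLoc).toFunctor.map l.iso.hom ≫ m.iso.hom) e)

end Restrict

/-! ### Restriction along a cone in the indexing category -/

section Cone

variable {J' : Type u₂} [Category.{v₂} J'] (K : J' ⥤ J) {j : J}
  (a : (Functor.const J').obj j ⟶ K)

variable (F) in
/-- The functor from a term of a diagram of categories to the pseudo-limit of a diagram below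
it. -/
abbrev coneLift : F.obj ⟨j⟩ ⥤ PseudoLimit (K.toPseudofunctor.comp F) :=
  (PseudoCone.ofNatTrans F K j a).lift

variable (X) in
/-- The compatible family of elements attached to an element at the apex of a cone. -/
def PresheafSystem.coneSection {c : F.obj ⟨j⟩} (y : (X.obj j).obj (op c)) :
    (X.restrict K).sections.obj (op ((coneLift F K a).obj c)) where
  el i := X.tr (a.app i) y
  compat {i i'} f := by
    have h := X.tr_comp' (a.app i) (K.map f) (a.app i') (by rw [← a.naturality f]; simp) y
    refine Eq.symm ((congrArg _ h).trans ?_)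
    refine (presheaf_map_comp_apply (X.obj (K.obj i')) _ _ _).symm.trans ?_
    have e := (F.mapComp' (a.app i).toLoc (K.map f).toLoc (a.app i').toLoc
      (toLoc_comp_naturality a f)).inv_hom_id
    have e' := congr(($e).toNatTrans.app c)
    exact (congrArg (fun t => (X.obj (K.obj i')).map (Quiver.Hom.op t) _) e').trans
      (ConcreteCategory.congr_hom ((X.obj (K.obj i')).map_id _) _)

variable (X) in
/-- The evaluation of compatible families of elements at an index. -/
def PresheafSystem.evalEl (j : J) : El X.sections ⥤ El (X.obj j) where
  obj p := ⟨p.pt.obj j, PresheafSystem.Section.el p.el j⟩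
  map f := ⟨f.hom.app j, congr(PresheafSystem.Section.el $(f.map_el) j)⟩
  map_id _ := rfl
  map_comp _ _ := rfl

/-- The comparison between an object of the pseudo-limit and the object induced by one of its
components. -/
def PseudoLimit.coneHom (Y : PseudoLimit F) :
    (coneLift F K a).obj (Y.obj j) ⟶ (PseudoLimit.restrict K).obj Y where
  app i := (Y.iso (a.app i)).hom
  naturality {i i'} f := by
    have h := Y.iso_comp' (a.app i) (K.map f) (a.app i') (by rw [← a.naturality f]; simp)
    have e := (F.mapComp' (a.app i).toLoc (K.map f).toLoc (a.app i').toLoc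
      (toLoc_comp_naturality a f)).inv_hom_id
    have e' := congr(($e).toNatTrans.app (Y.obj j))
    refine Eq.symm ((congrArg (_ ≫ ·) h).trans ?_)
    refine (Category.assoc _ _ _).symm.trans ?_
    exact (congrArg (· ≫ _) e').trans (Category.id_comp _)

end Cone

end Link

/-! ### Images of a cocone under the transition functors -/

theorem presheaf_map_map_of_comp_eq_id {C : Type u₁} [Category.{v₁} C] (X : Cᵒᵖ ⥤ Type w) {a b : C}
    {f : a ⟶ b} {g : b ⟶ a} (h : f ≫ g = 𝟙 a) (y : X.obj (op a)) :
    X.map f.op (X.map g.op y) = y := by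
  rw [← presheaf_map_comp_apply, h]
  simp

section Push

variable {J : Type u₁} [Category.{v₁} J] {F : LocallyDiscrete J ⥤ᵖ Cat.{v, u}}
  {X : PresheafSystem.{v, u, w} F} {A : Type w₁} [Category.{w₂} A] {d : A ⥤ El X.sections}

/-- The image of a cocone at a component by a transition functor. -/
def CoconeAt.push {i j : J} (z : CoconeAt d i) (f : i ⟶ j) : CoconeAt d j where
  pt := (F.map f.toLoc).toFunctor.obj z.pt
  el := X.tr f z.el
  leg a := ((d.obj a).pt.iso f).inv ≫ (F.map f.toLoc).toFunctor.map (z.leg a)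
  leg_nat {a a'} g := by
    have h : (F.map f.toLoc).toFunctor.map ((d.map g).hom.app i) ≫ ((d.obj a').pt.iso f).hom =
      ((d.obj a).pt.iso f).hom ≫ (d.map g).hom.app j := (d.map g).hom.naturality f
    rw [Iso.eq_inv_comp, ← Category.assoc, ← h, ← z.leg_nat g, Functor.map_comp]
    simp
  leg_el a := by
    rw [presheaf_map_comp_apply, ← X.tr_map, z.leg_el]
    refine (congrArg _ (PresheafSystem.Section.compat (d.obj a).el f)).trans ?_
    exact presheaf_map_map_of_comp_eq_id _ (Iso.inv_hom_id _) _

/-- The transition isomorphism between images of a cocone by transition functors. -/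
def CoconeAt.pushLink {i j k : J} (z : CoconeAt d i) (f : i ⟶ j) (g : j ⟶ k) (fg : i ⟶ k)
    (h : f ≫ g = fg) : Link g (z.push f) (z.push fg) where
  iso := ((Cat.Hom.toNatIso (F.mapComp' f.toLoc g.toLoc fg.toLoc (by rw [← h]; rfl))).app z.pt).symm
  tr_el := by
    have := X.tr_comp' f g fg h z.el
    refine Eq.symm ((congrArg _ this).trans ?_)
    exact presheaf_map_map_of_comp_eq_id (X.obj k) (Cat.Hom.inv_hom_id_toNatTrans_app
      (F.mapComp' f.toLoc g.toLoc fg.toLoc (by rw [← h]; rfl)) z.pt) _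
  map_leg a := by
    have h₁ := (d.obj a).pt.iso_comp' f g fg h
    have h₂ := (F.mapComp' f.toLoc g.toLoc fg.toLoc
      (by rw [← h]; rfl)).inv.toNatTrans.naturality (z.leg a)
    dsimp only [push]
    rw [Functor.map_comp, Category.assoc]
    refine (congrArg (_ ≫ ·) h₂).trans ?_
    rw [← Category.assoc, ← Category.assoc]
    congr 1
    rw [Iso.eq_comp_inv, h₁, Category.assoc]
    simp [← Functor.map_comp_assoc]

/-- This is the associativity coherence of the pseudofunctor `F`, evaluated at the point of `z`. -/
theorem CoconeAt.coh_pushLink {i₀ i₁ i₂ i₃ : J} (z : CoconeAt d i₀) (f₀₁ : i₀ ⟶ i₁) (f₁₂ : i₁ ⟶ i₂)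
    (f₂₃ : i₂ ⟶ i₃) (f₀₂ : i₀ ⟶ i₂) (f₁₃ : i₁ ⟶ i₃) (f : i₀ ⟶ i₃) (h₀₂ : f₀₁ ≫ f₁₂ = f₀₂)
    (h₁₃ : f₁₂ ≫ f₂₃ = f₁₃) (h₀ : f₀₂ ≫ f₂₃ = f) (h₁ : f₀₁ ≫ f₁₃ = f) :
    Link.Coh h₁₃ (z.pushLink f₀₁ f₁₂ f₀₂ h₀₂) (z.pushLink f₀₂ f₂₃ f h₀)
      (z.pushLink f₀₁ f₁₃ f h₁) := by
  have e := F.mapComp'₀₁₃_inv f₀₁.toLoc f₁₂.toLoc f₂₃.toLoc f₀₂.toLoc f₁₃.toLoc f.toLoc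
    (by rw [← h₀₂]; rfl) (by rw [← h₁₃]; rfl) (by rw [← h₁]; rfl)
  have e' := congr(($e).toNatTrans.app z.pt)
  refine e'.trans (congrArg (_ ≫ ·) ?_)
  exact Category.id_comp _

/-- The comparison of a cocone with its image by the transition functor of an identity. -/
def CoconeAt.toPush {j : J} (z : CoconeAt d j) (f : j ⟶ j) (h : f = 𝟙 j) :
    z.pt ⟶ (z.push f).pt :=
  (mapIdIso F f h).inv.toNatTrans.app z.pt

theorem CoconeAt.toPush_el {j : J} (z : CoconeAt d j) (f : j ⟶ j) (h : f = 𝟙 j) :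
    (X.obj j).map (z.toPush f h).op (z.push f).el = z.el := by
  refine (congrArg _ (X.tr_id' f h z.el)).trans ?_
  refine (presheaf_map_comp_apply (X.obj j) _ _ _).symm.trans ?_
  exact (congrArg (fun t => (X.obj j).map (Quiver.Hom.op t) z.el)
    (Cat.Hom.inv_hom_id_toNatTrans_app (mapIdIso F f h) z.pt)).trans
      (ConcreteCategory.congr_hom ((X.obj j).map_id _) _)

theorem CoconeAt.leg_toPush {j : J} (z : CoconeAt d j) (f : j ⟶ j) (h : f = 𝟙 j) (a : A) :
    z.leg a ≫ z.toPush f h = (z.push f).leg a := by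
  have h₁ := (d.obj a).pt.iso_id' f h
  have h₂ := (mapIdIso F f h).inv.toNatTrans.naturality (z.leg a)
  have h₃ : ((d.obj a).pt.iso f).inv = (mapIdIso F f h).inv.toNatTrans.app ((d.obj a).pt.obj j) := by
    have : (d.obj a).pt.iso f = (Cat.Hom.toNatIso (mapIdIso F f h)).app _ := Iso.ext h₁
    rw [this]
    rfl
  exact h₂.trans (congrArg (· ≫ _) h₃.symm)

end Push

/-- Dependent choice along a well-order, extending data given on a lower set. -/
theorem exists_extension_of_isLowerSet {ι : Type u₁} [LinearOrder ι] [WellFoundedLT ι]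
    {B : ι → Type u₂} (Good : ∀ γ, (∀ β, β < γ → B β) → B γ → Prop) {U : Set ι} (hU : IsLowerSet U)
    (t₀ : ∀ γ ∈ U, B γ)
    (h₀ : ∀ γ (hγ : γ ∈ U), Good γ (fun _ hβ => t₀ _ (hU hβ.le hγ)) (t₀ γ hγ))
    (hext : ∀ γ ∉ U, ∀ f : (∀ β, β < γ → B β),
      (∀ β (h : β < γ), Good β (fun β' h' => f β' (h'.trans h)) (f β h)) → ∃ e, Good γ f e) :
    ∃ t : ∀ γ, B γ, (∀ γ, Good γ (fun β _ => t β) (t γ)) ∧ ∀ γ hγ, t γ = t₀ γ hγ := by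
  classical
  -- Extensions exist only over good initial segments, so the recursion takes values in `Option`;
  -- `key` shows that the default `none` never occurs.
  let step (γ : ι) (f : ∀ β, β < γ → Option (B β)) : Option (B γ) :=
    if hγ : γ ∈ U then some (t₀ γ hγ) else
      if h : ∃ e, ∃ g : ∀ β, β < γ → B β, (∀ β h, f β h = some (g β h)) ∧ Good γ g e then
        some h.choose else none
  let s : ∀ γ, Option (B γ) := wellFounded_lt.fix step
  have hs (γ : ι) : s γ = step γ (fun β _ => s β) := wellFounded_lt.fix_eq step γ
  have hsU (γ : ι) (hγ : γ ∈ U) : s γ = some (t₀ γ hγ) := (hs γ).trans (dif_pos hγ)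
  have key (γ : ι) : ∃ e, s γ = some e ∧
      ∀ g : (∀ β, β < γ → B β), (∀ β h, s β = some (g β h)) → Good γ g e := by
    induction γ using WellFoundedLT.induction with
    | ind γ ih =>
      by_cases hγ : γ ∈ U
      · refine ⟨_, hsU γ hγ, fun g hg => ?_⟩
        obtain rfl : g = fun β hβ => t₀ β (hU hβ.le hγ) := by
          funext β hβ
          exact Option.some_injective _ ((hg β hβ).symm.trans (hsU β _))
        exact h₀ γ hγ
      · choose g hg hg' using ih
        have hgood : ∃ e, Good γ g e := hext γ hγ g fun β hβ =>
          hg' β hβ _ fun β' hβ' => hg β' (hβ'.trans hβ)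
        have hex : ∃ e, ∃ g : ∀ β, β < γ → B β,
            (∀ β h, s β = some (g β h)) ∧ Good γ g e :=
          ⟨_, g, hg, hgood.choose_spec⟩
        refine ⟨hex.choose, (hs γ).trans ((dif_neg hγ).trans (dif_pos hex)), fun g' hg'' => ?_⟩
        obtain ⟨g₁, h₁, h₂⟩ := hex.choose_spec
        obtain rfl : g' = g₁ := by
          funext β hβ
          exact Option.some_injective _ ((hg'' β hβ).symm.trans (h₁ β hβ))
        exact h₂
  choose t ht ht' using key
  exact ⟨t, fun γ => ht' γ _ fun β _ => ht β, fun γ hγ =>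
    Option.some_injective _ ((ht γ).symm.trans (hsU γ hγ))⟩

/-! ### Lifting of cocones along a tower of Street fibrations -/

/-- A system of presheaves all of whose terms admit small `κ`-filtered presentations which are
preserved by the transition maps. -/
def PresheafSystem.IsInd {J : Type u₁} [Category.{v₁} J] {F : LocallyDiscrete J ⥤ᵖ Cat.{v, u}}
    (X : PresheafSystem.{v, u, w} F) (κ : Cardinal.{w₁}) [Fact κ.IsRegular] : Prop :=
  ∀ j, ∃ (I : Type w₁) (_ : SmallCategory I) (_ : IsCardinalFiltered I κ) (D : I ⥤ F.obj ⟨j⟩)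
    (x : ∀ i, (X.obj j).obj (op (D.obj i))), IsPresentation D (X.obj j) x ∧
      ∀ {k : J} (f : j ⟶ k), IsPresentation (D ⋙ (F.map f.toLoc).toFunctor) (X.obj k)
        (fun i => X.tr f (x i))

theorem hasCardinalLT_arrow_of_isThin {J : Type u₁} [Category.{v₁} J] [Quiver.IsThin J]
    {κ : Cardinal.{w}} [Fact κ.IsRegular] (h : HasCardinalLT J κ) : HasCardinalLT (Arrow J) κ := by
  refine (hasCardinalLT_prod (Fact.out : κ.IsRegular).aleph0_le h h).of_injective
    (fun f => (f.left, f.right)) ?_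
  rintro ⟨a, b, f⟩ ⟨a', b', f'⟩ h
  obtain ⟨rfl, rfl⟩ := Prod.ext_iff.1 h
  obtain rfl : f = f' := Subsingleton.elim _ _
  rfl

section Tower

variable {ι : Type u₁} [LinearOrder ι] {C : LocallyDiscrete ιᵒᵖ ⥤ᵖ Cat.{v, u}}
  {X : PresheafSystem.{v, u, w} C} {A : Type w₁} [Category.{w₂} A] {d : A ⥤ El X.sections}

/-- The arrow attached to a strict inequality. -/
def arrowOfLT {β γ : ι} (h : β < γ) : op γ ⟶ op β :=
  (homOfLE h.le).op

variable (d) in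
/-- A cocone at a stage of a tower together with transition isomorphisms to cocones at all
previous stages. -/
abbrev Stage (γ : ι) :=
  Σ z : CoconeAt d (op γ), ∀ β (h : β < γ), Σ z' : CoconeAt d (op β), Link (arrowOfLT h) z z'

/-- The compatibility of a stage with the previous ones. -/
def Stage.Compatible (γ : ι) (s : ∀ β, β < γ → Stage d β) (t : Stage d γ) : Prop :=
  ∃ l : ∀ β (h : β < γ), Link (arrowOfLT h) t.1 (s β h).1,
    (∀ β h, t.2 β h = ⟨(s β h).1, l β h⟩) ∧
      ∀ β' β (h' : β' < β) (h : β < γ)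
        (m : Link (arrowOfLT h') (s β h).1 (s β' (h'.trans h)).1), (s β h).2 β' h' = ⟨_, m⟩ →
          Link.Coh (Subsingleton.elim _ _) (l β h) m (l β' (h'.trans h))

/-- The inductive step. Compatible stages below `γ` amount to a cocone in the pseudo-limit of the
restricted tower; lifting it along the comparison functor gives the cocone at `γ`, and the
components of the isomorphism `h` are the new links. -/
theorem exists_compatible_stage {κ : Cardinal.{w₃}} [Fact κ.IsRegular] (hι : HasCardinalLT ι κ)
    (hX : X.IsInd κ) (hA : HasCardinalLT (Arrow A) κ) (γ : ι)
    (hC : IsStreetFibration (comparisonBelow C γ)) (s : ∀ β, β < γ → Stage d β)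
    (hs : ∀ β (h : β < γ), Stage.Compatible β (fun β' h' => s β' (h'.trans h)) (s β h)) :
    ∃ t, Stage.Compatible γ s t := by
  choose l hl hl' using hs
  let K : (Set.Iio γ : Set ι)ᵒᵖ ⥤ ιᵒᵖ := (below γ).op
  have lt {i j : (Set.Iio γ : Set ι)ᵒᵖ} (f : i ⟶ j) (h : i ≠ j) : j.unop.1 < i.unop.1 :=
    lt_of_le_of_ne (leOfHom f.unop) fun e => h (unop_injective (Subtype.ext e.symm))
  let S : LinkSystem (d ⋙ X.restrictEl K) := .ofNe
    (fun f g => unop_injective (le_antisymm (leOfHom g.unop) (leOfHom f.unop)))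
    (fun j => (s j.unop.1 j.unop.2).1.restrict K)
    (fun {i j} f h => Link.restrict K (l i.unop.1 i.unop.2 j.unop.1 (lt f h)))
    (fun {i j k} f g hf hg hfg => by
      refine Link.Coh.restrict K ?_
      exact hl' _ _ _ _ _ _ _ (hl _ _ _ _))
  have hS {i j : (Set.Iio γ : Set ι)ᵒᵖ} (f : i ⟶ j) (h : i ≠ j) :
      S.link f = Link.restrict K (l i.unop.1 i.unop.2 j.unop.1 (lt f h)) :=
    LinkSystem.ofNe_link _ _ _ _ f h
  obtain ⟨I, _, _, D, x, hD, hD'⟩ := hX (op γ)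
  have hJ : HasCardinalLT (Arrow (Set.Iio γ : Set ι)ᵒᵖ) κ :=
    hasCardinalLT_arrow_of_isThin (hι.of_injective (fun j => j.unop.1)
      fun i j h => unop_injective (Subtype.ext h))
  -- The transition maps preserve the presentation `D` of `X γ`, so its image under the comparison
  -- functor presents the sections below `γ`, as the lifting lemma requires.
  obtain ⟨e, z, h, leg, leg_nat, leg_el, hz, hleg⟩ := hC.exists_lift_cocone (X := X.obj (op γ))
    (Y := (X.restrict K).sections) (fun y => X.coneSection K (belowCone γ) y)
    (fun f y => PresheafSystem.Section.ext (funext fun j => X.tr_map _ _ _)) hD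
    ((X.restrict K).sections_isPresentation hJ (D ⋙ comparisonBelow C γ) _
      (fun j => hD' ((belowCone γ).app j))) hA (d ⋙ X.evalEl (op γ)) S.toEl.pt S.toEl.el
    (fun a => PseudoLimit.coneHom K (belowCone γ) (d.obj a).pt ≫ (S.leg a).hom)
    (fun {a a'} f => by
      rw [← S.leg_nat f]
      refine PseudoLimit.Hom.ext (funext fun j => ?_)
      have := (d.map f).hom.naturality ((belowCone γ).app j)
      refine (Category.assoc _ _ _).symm.trans ((congrArg (· ≫ _) this).trans ?_)
      exact Category.assoc _ _ _)
    (fun a => by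
      refine (presheaf_map_comp_apply (X.restrict K).sections _ _ _).trans
        ((congrArg _ (S.leg a).map_el).trans ?_)
      refine PresheafSystem.Section.ext (funext fun j => ?_)
      exact (PresheafSystem.Section.compat (d.obj a).el ((belowCone γ).app j)).symm)
  let link (β : ι) (hβ : β < γ) : Link (arrowOfLT hβ) (CoconeAt.mk e z leg leg_nat leg_el :
      CoconeAt d (op γ)) (s β hβ).1 :=
    let jβ : (Set.Iio γ : Set ι)ᵒᵖ := op ⟨β, hβ⟩
    { iso := (PseudoLimit.proj (restrictBelow C γ) jβ).mapIso h
      tr_el := congr(PresheafSystem.Section.el $hz (op ⟨β, hβ⟩))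
      map_leg := fun a => congr(PseudoLimit.Hom.app $(hleg a) (op ⟨β, hβ⟩)) }
  refine ⟨⟨_, fun β hβ => ⟨_, link β hβ⟩⟩, link, fun _ _ => rfl, fun β' β h' hβ m hm => ?_⟩
  -- The link recorded in stage `β` is the chosen one; quantifying over `m` in `Stage.Compatible`
  -- avoids transport along an equality of cocones.
  obtain rfl : l β hβ β' h' = m := by
    have := (hl β hβ β' h').symm.trans hm
    exact eq_of_heq (Sigma.mk.inj this).2
  let f : (op ⟨β, hβ⟩ : (Set.Iio γ : Set ι)ᵒᵖ) ⟶ op ⟨β', h'.trans hβ⟩ :=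
    (homOfLE h'.le : (⟨β', h'.trans hβ⟩ : (Set.Iio γ : Set ι)) ⟶ ⟨β, hβ⟩).op
  have nat := h.hom.naturality f
  have hne : (op ⟨β, hβ⟩ : (Set.Iio γ : Set ι)ᵒᵖ) ≠ op ⟨β', h'.trans hβ⟩ := fun e =>
    h'.ne (congrArg (fun j => j.unop.1) e).symm
  have iso_f : (S.toEl.pt.iso f).hom = (l β hβ β' h').iso.hom := congr(($(hS f hne)).iso.hom)
  have e' := congr(($((C.mapComp' (arrowOfLT hβ).toLoc (arrowOfLT h').toLoc
    (arrowOfLT (h'.trans hβ)).toLoc).hom_inv_id)).toNatTrans.app e)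
  -- Coherence is naturality of `h.hom` at `f`; the structure isomorphism of the comparison object
  -- is an inverse `mapComp'`, cancelled here by `e'`.
  refine (Category.id_comp _).symm.trans ((congrArg (· ≫ _) e'.symm).trans ?_)
  refine (Category.assoc _ _ _).trans (congrArg (_ ≫ ·) ?_)
  refine nat.symm.trans ?_
  exact congrArg (_ ≫ ·) iso_f

end Tower

section Tower

variable {ι : Type u₁} [LinearOrder ι] {C : LocallyDiscrete ιᵒᵖ ⥤ᵖ Cat.{v, u}}
  {X : PresheafSystem.{v, u, w} C} {A : Type w₁} [Category.{w₂} A] {d : A ⥤ El X.sections}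

theorem exists_linkSystem (t : ∀ γ, Stage d γ)
    (ht : ∀ γ, Stage.Compatible γ (fun β _ => t β) (t γ)) :
    ∃ S : LinkSystem d, ∀ γ, S.z (op γ) = (t γ).1 := by
  choose l hl hl' using ht
  have lt {i j : ιᵒᵖ} (f : i ⟶ j) (h : i ≠ j) : j.unop < i.unop :=
    lt_of_le_of_ne (leOfHom f.unop) fun e => h (unop_injective e.symm)
  exact ⟨.ofNe (fun f g => unop_injective (le_antisymm (leOfHom g.unop) (leOfHom f.unop)))
    (fun j => (t j.unop).1) (fun {i j} f h => l i.unop j.unop (lt f h))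
    (fun {i j k} f g hf hg hfg => hl' _ _ _ _ _ _ (hl _ _ _)), fun _ => rfl⟩

variable [WellFoundedLT ι] {κ : Cardinal.{w₃}} [Fact κ.IsRegular]

theorem exists_linkSystem_of_isLowerSet (hι : HasCardinalLT ι κ)
    (hC : ∀ γ, IsStreetFibration (comparisonBelow C γ)) (hX : X.IsInd κ)
    (hA : HasCardinalLT (Arrow A) κ) {U : Set ι} (hU : IsLowerSet U) (t₀ : ∀ γ ∈ U, Stage d γ)
    (h₀ : ∀ γ (hγ : γ ∈ U), Stage.Compatible γ (fun _ hβ => t₀ _ (hU hβ.le hγ)) (t₀ γ hγ)) :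
    ∃ S : LinkSystem d, ∀ γ hγ, S.z (op γ) = (t₀ γ hγ).1 := by
  obtain ⟨t, ht, ht'⟩ := exists_extension_of_isLowerSet (B := Stage d) Stage.Compatible hU t₀ h₀
    fun γ _ s hs => exists_compatible_stage hι hX hA γ (hC γ) s hs
  obtain ⟨S, hS⟩ := exists_linkSystem t ht
  exact ⟨S, fun γ hγ => (hS γ).trans (congrArg Sigma.fst (ht' γ hγ))⟩

theorem isCardinalFiltered_el_sections (hι : HasCardinalLT ι κ)
    (hC : ∀ γ, IsStreetFibration (comparisonBelow C γ)) (hX : X.IsInd κ) :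
    IsCardinalFiltered (El X.sections) κ where
  nonempty_cocone {A} _ d hA := by
    obtain ⟨S, -⟩ := exists_linkSystem_of_isLowerSet (d := d) hι hC hX hA (U := ∅)
      (fun _ _ _ h => h) (fun _ h => h.elim) (fun _ h => h.elim)
    exact ⟨{ pt := S.toEl, ι := { app := S.leg, naturality := fun _ _ f => by simp [S.leg_nat] } }⟩

/-- Below and at `γ` the images of `z` are prescribed, and the recursion continues above. At `γ`
itself the result is the image of `z` under the functor of an identity, only isomorphic to `z`;
hence the comparison arrow `m`. -/
theorem exists_cocone_extending (hι : HasCardinalLT ι κ)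
    (hC : ∀ γ, IsStreetFibration (comparisonBelow C γ)) (hX : X.IsInd κ)
    (hA : HasCardinalLT (Arrow A) κ) {γ : ι} (z : CoconeAt d (op γ)) :
    ∃ (k : El X.sections) (l : ∀ a, d.obj a ⟶ k) (m : z.pt ⟶ k.pt.obj (op γ)),
      (X.obj (op γ)).map m.op (PresheafSystem.Section.el k.el (op γ)) = z.el ∧
        ∀ a, z.leg a ≫ m = (l a).hom.app (op γ) := by
  let arr {β : ι} (h : β ≤ γ) : op γ ⟶ op β := (homOfLE h).op
  obtain ⟨S, hS⟩ := exists_linkSystem_of_isLowerSet (d := d) hι hC hX hA (U := Set.Iic γ)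
    (isLowerSet_Iic γ)
    (fun β hβ => ⟨z.push (arr hβ), fun β' hβ' => ⟨z.push (arr (hβ'.le.trans hβ)),
      z.pushLink _ _ _ (Subsingleton.elim _ _)⟩⟩)
    (fun β hβ => ⟨fun β' hβ' => z.pushLink _ _ _ (Subsingleton.elim _ _), fun _ _ => rfl,
      fun β' β'' h' h m hm => by
        obtain rfl := eq_of_heq (Sigma.mk.inj hm).2
        exact z.coh_pushLink _ _ _ _ _ _ _ _ _ _⟩)
  have h := hS γ le_rfl
  obtain ⟨m, hm, hm'⟩ : ∃ m : z.pt ⟶ (S.z (op γ)).pt,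
      (X.obj (op γ)).map m.op (S.z (op γ)).el = z.el ∧
        ∀ a, z.leg a ≫ m = (S.z (op γ)).leg a := by
    rw [h]
    exact ⟨z.toPush _ (Subsingleton.elim _ _), z.toPush_el _ _, z.leg_toPush _ _⟩
  exact ⟨S.toEl, S.leg, m, hm, hm'⟩

end Tower

/-! ### Small cardinal filtered subcategories -/

/-- Iterate `Φ` along `κ.ord`. By regularity a subset of the union with fewer than `κ` elements
already lies in earlier terms; smallness persists because a small set has a small power set. -/
theorem exists_small_closed {K : Type u₁} {κ : Cardinal.{w}} [Fact κ.IsRegular]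
    (Φ : Set K → Set K) (hΦ : ∀ S : Set K, HasCardinalLT S κ → Small.{w} (Φ S)) :
    ∃ T : Set K, Small.{w} T ∧ ∀ S ⊆ T, HasCardinalLT S κ → Φ S ⊆ T := by
  let step (ξ : κ.ord.ToType) (f : ∀ η, η < ξ → Set K) : Set K :=
    ⋃ S ∈ {S : Set K | S ⊆ (⋃ η : {η // η < ξ}, f η.1 η.2) ∧ HasCardinalLT S κ}, Φ S
  let T : κ.ord.ToType → Set K := wellFounded_lt.fix step
  have hT (ξ : κ.ord.ToType) : T ξ = step ξ (fun η _ => T η) := wellFounded_lt.fix_eq step ξ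
  have small (ξ : κ.ord.ToType) : Small.{w} (T ξ) := by
    induction ξ using WellFoundedLT.induction with
    | ind ξ ih =>
      rw [hT]
      have : Small.{w} (⋃ η : {η // η < ξ}, T η.1 : Set K) := by
        have (η : {η // η < ξ}) : Small.{w} (T η.1) := ih _ η.2
        infer_instance
      have h₁ : Small.{w} {S : Set K | S ⊆ (⋃ η : {η // η < ξ}, T η.1) ∧ HasCardinalLT S κ} :=
        small_subset (s := 𝒫 (⋃ η : {η // η < ξ}, T η.1)) fun S hS => hS.1
      dsimp only [step]
      rw [Set.biUnion_eq_iUnion]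
      have h₂ (S : {S : Set K | S ⊆ (⋃ η : {η // η < ξ}, T η.1) ∧ HasCardinalLT S κ}) :
        Small.{w} (Φ S) := hΦ _ S.2.2
      infer_instance
  refine ⟨⋃ ξ, T ξ, inferInstance, fun S hS hS' => ?_⟩
  have : NoMaxOrder κ.ord.ToType := Cardinal.noMaxOrder (Fact.out : κ.IsRegular).aleph0_le
  choose ξ hξ using fun s : S => Set.mem_iUnion.1 (hS s.2)
  -- The bound must be strict: `T ζ` applies `Φ` only to subsets of the terms of index less than
  -- `ζ`.
  obtain ⟨ζ, hζ⟩ := exists_gt (IsCardinalFiltered.max ξ hS')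
  refine Set.Subset.trans ?_ (Set.subset_iUnion T ζ)
  rw [hT]
  refine Set.subset_biUnion_of_mem (u := Φ) ⟨fun s hs => ?_, hS'⟩
  exact Set.mem_iUnion.2 ⟨⟨ξ ⟨s, hs⟩,
    (leOfHom (IsCardinalFiltered.toMax ξ hS' ⟨s, hs⟩)).trans_lt hζ⟩, hξ ⟨s, hs⟩⟩

/-- Close `S₀` under `G`, chosen upper bounds of subsets and chosen coequalizing objects. Local
smallness keeps the sets of parallel families small, and fullness makes it enough to add objects. -/
theorem exists_small_isCardinalFiltered {K : Type u₁} [Category.{v₁} K] [LocallySmall.{w} K]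
    {κ : Cardinal.{w}} [Fact κ.IsRegular] [IsCardinalFiltered K κ] (S₀ : Set K) [Small.{w} S₀]
    (G : K → Set K) [∀ k, Small.{w} (G k)] :
    ∃ T : Set K, Small.{w} T ∧ S₀ ⊆ T ∧ (∀ k ∈ T, G k ⊆ T) ∧
      IsCardinalFiltered (ObjectProperty.FullSubcategory (· ∈ T)) κ := by
  have hκ : Cardinal.aleph0 ≤ κ := (Fact.out : κ.IsRegular).aleph0_le
  have h₁ (S : Set K) : ∃ k, HasCardinalLT S κ → ∀ s ∈ S, Nonempty (s ⟶ k) := by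
    by_cases hS : HasCardinalLT S κ
    · exact ⟨IsCardinalFiltered.max (fun s : S => s.1) hS, fun _ s hs =>
        ⟨IsCardinalFiltered.toMax (fun s : S => s.1) hS ⟨s, hs⟩⟩⟩
    · exact ⟨(IsCardinalFiltered.nonempty K κ).some, fun h => (hS h).elim⟩
  have h₂ (k k' : K) (V : Set (k ⟶ k')) : ∃ l, HasCardinalLT V κ →
      ∃ (a : k' ⟶ l) (b : k ⟶ l), ∀ f ∈ V, f ≫ a = b := by
    by_cases hV : HasCardinalLT V κ
    · exact ⟨IsCardinalFiltered.coeq (fun f : V => f.1) hV, fun _ =>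
        ⟨IsCardinalFiltered.coeqHom (fun f : V => f.1) hV,
          IsCardinalFiltered.toCoeq (fun f : V => f.1) hV, fun f hf =>
          IsCardinalFiltered.coeq_condition (fun f : V => f.1) hV ⟨f, hf⟩⟩⟩
    · exact ⟨k, fun h => (hV h).elim⟩
  choose ub hub using h₁
  choose eq heq using h₂
  obtain ⟨T, hT, hT'⟩ := exists_small_closed.{w} (κ := κ)
    (fun S => S₀ ∪ (⋃ s : S, G s) ∪ {ub S} ∪
      ⋃ (s : S) (s' : S), Set.range (eq s.1 s'.1)) (fun S hS => by
        have : Small.{w} S := hS.small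
        infer_instance)
  have hsingle (k : K) : HasCardinalLT ({k} : Set K) κ := hasCardinalLT_of_finite _ _ hκ
  refine ⟨T, hT, ?_, fun k hk => ?_, isCardinalFiltered_iff _ _ |>.2
    ⟨fun B j hB => ?_, fun B j k f hB => ?_⟩⟩
  · exact Set.Subset.trans (fun k hk => Or.inl (Or.inl (Or.inl hk)))
      (hT' ∅ (Set.empty_subset _) (hasCardinalLT_of_finite _ _ hκ))
  · exact Set.Subset.trans (fun l hl => Or.inl (Or.inl (Or.inr
      (Set.mem_iUnion.2 ⟨⟨k, rfl⟩, hl⟩)))) (hT' {k} (by simpa using hk) (hsingle k))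
  · have hS : HasCardinalLT (Set.range fun b => (j b).obj) κ :=
      hB.of_surjective (Set.rangeFactorization _) Set.rangeFactorization_surjective
    refine ⟨⟨_, hT' (Set.range fun b => (j b).obj) ?_ hS (Or.inl (Or.inr rfl))⟩, fun b =>
      ⟨ObjectProperty.homMk (hub _ hS _ ⟨b, rfl⟩).some⟩⟩
    rintro _ ⟨b, rfl⟩
    exact (j b).property
  · have hV : HasCardinalLT (Set.range fun b => (f b).hom) κ :=
      hB.of_surjective (Set.rangeFactorization _) Set.rangeFactorization_surjective
    obtain ⟨a, b, hab⟩ := heq _ _ _ hV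
    have hS : HasCardinalLT ({j.obj, k.obj} : Set K) κ := hasCardinalLT_of_finite _ _ hκ
    refine ⟨⟨_, hT' {j.obj, k.obj} ?_ hS (Or.inr (Set.mem_iUnion.2 ⟨⟨j.obj, Or.inl rfl⟩,
      Set.mem_iUnion.2 ⟨⟨k.obj, Or.inr rfl⟩, ⟨_, rfl⟩⟩⟩))⟩, ObjectProperty.homMk a,
      ObjectProperty.homMk b, fun i => ObjectProperty.hom_ext _ (hab _ ⟨i, rfl⟩)⟩
    rintro _ (rfl | rfl)
    · exact j.property
    · exact k.property

namespace IsPresentation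

variable {I : Type u₁} [Category.{v₁} I] {C : Type u₂} [Category.{v₂} C]
  {D : I ⥤ C} {X : Cᵒᵖ ⥤ Type w} {x : ∀ i, X.obj (op (D.obj i))}

theorem precomp {I' : Type u₃} [Category.{v₃} I'] (F : I' ⥤ I) [F.Full] [F.EssSurj]
    (h : IsPresentation D X x) : IsPresentation (F ⋙ D) X (fun i => x (F.obj i)) where
  map_eq f := h.map_eq (F.map f)
  exists_rep {c} y := by
    obtain ⟨i, a, rfl⟩ := h.exists_rep y
    refine ⟨F.objPreimage i, a ≫ D.map (F.objObjPreimageIso i).inv, ?_⟩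
    refine (presheaf_map_comp_apply X _ _ _).trans ?_
    rw [h.map_eq]
  exists_eq {c i} a b hab := by
    obtain ⟨j, f, hf⟩ := h.exists_eq a b hab
    refine ⟨F.objPreimage j, F.preimage (f ≫ (F.objObjPreimageIso j).inv), ?_⟩
    have := congr($hf ≫ D.map (F.objObjPreimageIso j).inv)
    simpa using this

/-- An interleaving argument: `h₁` carries representatives over to `D'`. For equality, a term of
`D'` maps to one of `D`, two arrows are identified there, and `h₂` absorbs that identification into
a transition of `D'`. -/
theorem of_extensions (h : IsPresentation D X x) {I' : Type u₃} [Category.{v₃} I'] {D' : I' ⥤ C}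
    {x' : ∀ i, X.obj (op (D'.obj i))} (map_eq : ∀ {i j : I'} (f : i ⟶ j),
      X.map (D'.map f).op (x' j) = x' i)
    (h₁ : ∀ s, ∃ (i : I') (m : D.obj s ⟶ D'.obj i), X.map m.op (x' i) = x s)
    (h₂ : ∀ i, ∃ (s : I) (a : D'.obj i ⟶ D.obj s), X.map a.op (x s) = x' i ∧
      ∀ (s' : I) (φ : s ⟶ s'), ∃ (i' : I') (f : i ⟶ i') (t : D.obj s' ⟶ D'.obj i'),
        (a ≫ D.map φ) ≫ t = D'.map f) : IsPresentation D' X x' where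
  map_eq := map_eq
  exists_rep {c} y := by
    obtain ⟨s, a, rfl⟩ := h.exists_rep y
    obtain ⟨i, m, hm⟩ := h₁ s
    exact ⟨i, a ≫ m, by rw [presheaf_map_comp_apply, hm]⟩
  exists_eq {c i} f g hfg := by
    obtain ⟨s, a, ha, hs⟩ := h₂ i
    obtain ⟨s', φ, hφ⟩ := h.exists_eq (f ≫ a) (g ≫ a) (by
      rw [presheaf_map_comp_apply, presheaf_map_comp_apply, ha, hfg])
    obtain ⟨i', l, t, ht⟩ := hs s' φ
    refine ⟨i', l, ?_⟩
    rw [← ht]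
    simpa using congr($hφ ≫ t)

end IsPresentation

/-! ### A small diagram in the pseudo-limit presenting all components -/

section Tower

variable {ι : Type v} [LinearOrder ι] [WellFoundedLT ι] {κ : Cardinal.{v}} [Fact κ.IsRegular]
  {C : LocallyDiscrete ιᵒᵖ ⥤ᵖ Cat.{v, u}} {X : PresheafSystem.{v, u, w} C}

theorem PresheafSystem.IsInd.exists_isPresentation (hι : HasCardinalLT ι κ)
    (hC : ∀ γ, IsStreetFibration (comparisonBelow C γ)) (hX : X.IsInd κ) :
    ∃ (I : Type v) (_ : SmallCategory I) (_ : IsCardinalFiltered I κ) (D : I ⥤ PseudoLimit C)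
      (x : ∀ i, X.sections.obj (op (D.obj i))), ∀ j, IsPresentation (D ⋙ PseudoLimit.proj C j)
        (X.obj j) (fun i => PresheafSystem.Section.el (x i) j) := by
  have hκ : Cardinal.aleph0 ≤ κ := (Fact.out : κ.IsRegular).aleph0_le
  have := isCardinalFiltered_el_sections hι hC hX
  have hX' := hX
  choose I _ _ D x hP hP' using hX'
  have h₁ (p : Σ j, I j) : ∃ (k : El X.sections) (m : (D p.1).obj p.2 ⟶ k.pt.obj p.1),
      (X.obj p.1).map m.op (PresheafSystem.Section.el k.el p.1) = x p.1 p.2 := by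
    obtain ⟨j, s⟩ := p
    -- A cocone over the empty diagram: each generator of `X j` maps to a component of a section,
    -- giving the first interleaving condition.
    let z : CoconeAt (Functor.empty.{0} (El X.sections)) (op j.unop) :=
      { pt := (D j).obj s
        el := x j s
        leg := fun a => a.as.elim
        leg_nat := fun {a} => a.as.elim
        leg_el := fun a => a.as.elim }
    obtain ⟨k, l, m, hm, -⟩ := exists_cocone_extending hι hC hX
      (hasCardinalLT_of_finite _ _ hκ) z
    exact ⟨k, m, hm⟩
  choose k₀ m hm using h₁
  have h₂ (k : El X.sections) (j : ιᵒᵖ) : ∃ (s : I j) (a : k.pt.obj j ⟶ (D j).obj s),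
      (X.obj j).map a.op (x j s) = PresheafSystem.Section.el k.el j :=
    (hP j).exists_rep _
  choose s a ha using h₂
  have h₃ (k : El X.sections) (p : Σ (j : ιᵒᵖ) (s' : I j), s k j ⟶ s') :
      ∃ (k' : El X.sections) (l : k ⟶ k') (t : (D p.1).obj p.2.1 ⟶ k'.pt.obj p.1),
        (a k p.1 ≫ (D p.1).map p.2.2) ≫ t = l.hom.app p.1 := by
    obtain ⟨j, s', φ⟩ := p
    -- A cocone over the single object `k`: an arrow out of its `j`-th component is completed to a
    -- component of a morphism out of `k`, giving the second condition.
    let z : CoconeAt ((Functor.const (Discrete PUnit.{1})).obj k) (op j.unop) :=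
      { pt := (D j).obj s'
        el := x j s'
        leg := fun _ => a k j ≫ (D j).map φ
        leg_nat := fun _ => Category.id_comp _
        leg_el := fun _ => by
          refine (presheaf_map_comp_apply (X.obj j) _ _ _).trans ?_
          rw [(hP j).map_eq]
          exact ha k j }
    obtain ⟨k', l, m, -, hm⟩ := exists_cocone_extending hι hC hX
      (hasCardinalLT_of_finite _ _ hκ) z
    exact ⟨k', l ⟨⟨⟩⟩, m, hm ⟨⟨⟩⟩⟩
  choose k' l t hl using h₃
  obtain ⟨T, _, hT₀, hT, hT'⟩ := exists_small_isCardinalFiltered.{v} (κ := κ) (Set.range k₀)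
    (fun k => Set.range (k' k))
  let E := equivSmallModel.{v} (ObjectProperty.FullSubcategory (· ∈ T))
  refine ⟨_, inferInstance, .of_equivalence κ E,
    E.inverse ⋙ ObjectProperty.ι (· ∈ T) ⋙ El.forget X.sections, fun i => (E.inverse.obj i).obj.el,
    fun j => ?_⟩
  refine IsPresentation.precomp (D := ObjectProperty.ι (· ∈ T) ⋙ El.forget X.sections ⋙
    PseudoLimit.proj C j) (x := fun p => PresheafSystem.Section.el p.obj.el j) E.inverse ?_
  refine (hP j).of_extensions (fun f => congr(PresheafSystem.Section.el $(f.hom.map_el) j))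
    (fun s => ⟨⟨k₀ ⟨j, s⟩, hT₀ ⟨_, rfl⟩⟩, m ⟨j, s⟩, hm ⟨j, s⟩⟩)
    (fun p => ⟨s p.obj j, a p.obj j, ha p.obj j, fun s' φ => ?_⟩)
  exact ⟨⟨k' p.obj ⟨j, s', φ⟩, hT _ p.property ⟨_, rfl⟩⟩,
    ObjectProperty.homMk (l p.obj ⟨j, s', φ⟩), t p.obj ⟨j, s', φ⟩, hl p.obj ⟨j, s', φ⟩⟩

end Tower

/-! ### Systems of ind-objects -/

section IndSystem

variable {κ : Cardinal.{v}} [Fact κ.IsRegular] {J : Type u₁} [Category.{v₁} J]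
  {C : LocallyDiscrete J ⥤ᵖ Cat.{v, max u v}}

/-- The transition map of a compatible family of ind-objects. -/
noncomputable def indTr (X : PseudoLimit (C.comp (Ind.{v, u} κ))) {i j : J} (f : i ⟶ j)
    {c : C.obj ⟨i⟩} (y : (X.obj i).obj.obj (op c)) :
    (X.obj j).obj.obj (op ((C.map f.toLoc).toFunctor.obj c)) :=
  (X.iso f).hom.hom.app _ (indUnit κ (C.map f.toLoc) (X.obj i) y)

theorem ind_hom_map_apply {D : Cat.{v, max u v}} {P Q : (Ind.{v, u} κ).obj D} (g : P ⟶ Q)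
    {c c' : D} (f : c' ⟶ c) (p : P.obj.obj (op c)) :
    g.hom.app _ (P.obj.map f.op p) = Q.obj.map f.op (g.hom.app _ p) :=
  NatTrans.naturality_apply g.hom f.op p

/-- The system of presheaves underlying a compatible family of ind-objects. -/
noncomputable def indSystem (X : PseudoLimit (C.comp (Ind.{v, u} κ))) :
    PresheafSystem.{v, max u v, max u v} C where
  obj j := (X.obj j).obj
  tr f _ y := indTr X f y
  tr_map {i j} f c c' g y := by
    refine (congrArg ((X.iso f).hom.hom.app _) (indUnit_map _ _ _ _)).trans ?_
    exact ind_hom_map_apply _ _ _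
  tr_id {j c} y := by
    have h : (X.iso (𝟙 j)).hom = ((Ind.{v, u} κ).map₂ (C.mapId ⟨j⟩).hom).toNatTrans.app (X.obj j) ≫
      ((Ind.{v, u} κ).mapId (C.obj ⟨j⟩)).hom.toNatTrans.app (X.obj j) := X.iso_id j
    refine (congrArg (fun t => t.hom.app _ (indUnit κ (C.map (𝟙 j : j ⟶ j).toLoc) (X.obj j) y))
      h).trans ?_
    refine (congrArg (fun t => (((Ind.{v, u} κ).mapId (C.obj ⟨j⟩)).hom.toNatTrans.app
      (X.obj j)).hom.app _ t) (ind_map₂_indUnit (C.mapId ⟨j⟩).hom (X.obj j) y)).trans ?_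
    refine (ind_hom_map_apply _ _ _).trans ?_
    exact congrArg _ (ind_mapId_indUnit (X.obj j) y)
  tr_comp {i j k} f g c y := by
    have h : (X.iso (f ≫ g)).hom =
      ((Ind.{v, u} κ).map₂ (C.mapComp f.toLoc g.toLoc).hom).toNatTrans.app (X.obj i) ≫
      ((Ind.{v, u} κ).mapComp (C.map f.toLoc) (C.map g.toLoc)).hom.toNatTrans.app (X.obj i) ≫
      ((Ind.{v, u} κ).map (C.map g.toLoc)).toFunctor.map (X.iso f).hom ≫ (X.iso g).hom :=
      (X.iso_comp f g).trans (Category.assoc _ _ _)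
    refine (congrArg (fun t => t.hom.app _ (indUnit κ (C.map (f ≫ g).toLoc) (X.obj i) y))
      h).trans ?_
    refine (congrArg (fun t => (X.iso g).hom.hom.app _
      ((((Ind.{v, u} κ).map (C.map g.toLoc)).toFunctor.map (X.iso f).hom).hom.app _
        ((((Ind.{v, u} κ).mapComp (C.map f.toLoc) (C.map g.toLoc)).hom.toNatTrans.app
          (X.obj i)).hom.app _ t)))
            (ind_map₂_indUnit (C.mapComp f.toLoc g.toLoc).hom (X.obj i) y)).trans ?_
    refine (congrArg (fun t => (X.iso g).hom.hom.app _
      ((((Ind.{v, u} κ).map (C.map g.toLoc)).toFunctor.map (X.iso f).hom).hom.app _ t))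
        (ind_hom_map_apply _ _ _)).trans ?_
    refine (congrArg (fun t => (X.iso g).hom.hom.app _ t) (ind_hom_map_apply _ _ _)).trans ?_
    refine (ind_hom_map_apply _ _ _).trans (congrArg _ ?_)
    refine (congrArg (fun t => (X.iso g).hom.hom.app _
      ((((Ind.{v, u} κ).map (C.map g.toLoc)).toFunctor.map (X.iso f).hom).hom.app _ t))
        (ind_mapComp_indUnit _ _ _ _)).trans ?_
    exact congrArg (fun t => (X.iso g).hom.hom.app _ t) (ind_map_map_indUnit _ _ _)

theorem isPresentation_indUnit {D E : Cat.{v, max u v}} (F : D ⟶ E) (P : (Ind.{v, u} κ).obj D)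
    {I : Type v} [SmallCategory I] [IsFiltered I] {K : I ⥤ D}
    {x : ∀ i, P.obj.obj (op (K.obj i))} (h : IsPresentation K P.obj x) :
    IsPresentation (K ⋙ F.toFunctor) (((Ind.{v, u} κ).map F).toFunctor.obj P).obj
      (fun i => indUnit κ F P (x i)) :=
  h.lan F.toFunctor

theorem indSystem_isInd (X : PseudoLimit (C.comp (Ind.{v, u} κ))) : (indSystem X).IsInd κ := by
  intro j
  obtain ⟨I, _, hI, K, x, h⟩ := IsIndObj.exists_isPresentation.{v, u} (X.obj j).property
  have := isFiltered_of_isCardinalFiltered I κ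
  refine ⟨I, _, hI, K, x, h, fun {k} f => ?_⟩
  exact (isPresentation_indUnit (C.map f.toLoc) (X.obj j) h).of_iso
    ((ObjectProperty.ι _).mapIso (X.iso f))

end IndSystem

theorem PseudoLimit.isIso_of_app {J : Type u₁} [Category.{v₁} J]
    {F : LocallyDiscrete J ⥤ᵖ Cat.{v, u}} {X Y : PseudoLimit F} (f : X ⟶ Y)
    (hf : ∀ j, IsIso (f.app j)) : IsIso f := by
  let g : Y ⟶ X :=
    { app := fun j => inv (f.app j)
      naturality := fun {i j} φ => by
        rw [IsIso.eq_comp_inv, Functor.map_inv, Category.assoc, IsIso.inv_comp_eq]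
        exact (f.naturality φ).symm }
  exact ⟨g, Hom.ext (funext fun j => IsIso.hom_inv_id (f.app j)),
    Hom.ext (funext fun j => IsIso.inv_hom_id (f.app j))⟩

/-! ### Morphisms of compatible families of ind-objects -/

section

variable {κ : Cardinal.{v}} [Fact κ.IsRegular] {J : Type u₁} [Category.{v₁} J]
  {C : LocallyDiscrete J ⥤ᵖ Cat.{v, max u v}}

theorem indTr_naturality {X X' : PseudoLimit (C.comp (Ind.{v, u} κ))} (g : X ⟶ X') {i j : J}
    (f : i ⟶ j) {c : C.obj ⟨i⟩} (y : (X.obj i).obj.obj (op c)) :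
    (g.app j).hom.app _ (indTr X f y) = indTr X' f ((g.app i).hom.app _ y) := by
  have h : ((Ind.{v, u} κ).map (C.map f.toLoc)).toFunctor.map (g.app i) ≫ (X'.iso f).hom =
    (X.iso f).hom ≫ g.app j := g.naturality f
  have h' := congr(($h).hom.app _ (indUnit κ (C.map f.toLoc) (X.obj i) y))
  refine h'.symm.trans ?_
  exact congrArg ((X'.iso f).hom.hom.app _) (ind_map_map_indUnit _ _ _)

/-- A morphism between compatible families of ind-objects, from components commuting with the
transition maps. -/
def homOfIndTr {X X' : PseudoLimit (C.comp (Ind.{v, u} κ))} (g : ∀ j, X.obj j ⟶ X'.obj j)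
    (hg : ∀ {i j : J} (f : i ⟶ j) {c : C.obj ⟨i⟩} (y : (X.obj i).obj.obj (op c)),
      (g j).hom.app _ (indTr X f y) = indTr X' f ((g i).hom.app _ y)) : X ⟶ X' where
  app := g
  naturality {i j} f := by
    refine ind_hom_ext (C.map f.toLoc) (X.obj i) (X'.obj j) fun c y => ?_
    refine Eq.trans ?_ (hg f y).symm
    exact congrArg ((X'.iso f).hom.hom.app _) (ind_map_map_indUnit _ _ _)

theorem exists_indUnit {D E : Cat.{v, max u v}} (F : D ⟶ E) (P : (Ind.{v, u} κ).obj D) {c : E}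
    (y : (((Ind.{v, u} κ).map F).toFunctor.obj P).obj.obj (op c)) :
    ∃ (d : D) (p : P.obj.obj (op d)) (a : c ⟶ F.toFunctor.obj d),
      (((Ind.{v, u} κ).map F).toFunctor.obj P).obj.map a.op (indUnit κ F P p) = y := by
  obtain ⟨I, _, hI, K, x, h⟩ := IsIndObj.exists_isPresentation.{v, u} P.property
  have := isFiltered_of_isCardinalFiltered I κ
  obtain ⟨i, a, ha⟩ := (isPresentation_indUnit F P h).exists_rep y
  exact ⟨_, x i, a, ha⟩

/-- The coherence `mapComp` cancels on iterated units, leaving the 2-cell of `c.iso f`. It is what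
makes the unit elements of `p` a section. -/
theorem indTr_indUnit {L : Cat.{v, max u v}} (c : PseudoCone C L) (P : (Ind.{v, u} κ).obj L)
    {i j : J} (f : i ⟶ j) {Y : L} (p : P.obj.obj (op Y)) :
    indTr ((c.map (Ind.{v, u} κ)).lift.obj P) f (indUnit κ (c.π i) P p) =
      (((Ind.{v, u} κ).map (c.π j)).toFunctor.obj P).obj.map ((c.iso f).hom.toNatTrans.app Y).op
        (indUnit κ (c.π j) P p) := by
  refine Eq.trans ?_ (ind_map₂_indUnit (c.iso f).hom P p)
  refine congrArg ((((Ind.{v, u} κ).map₂ (c.iso f).hom).toNatTrans.app P).hom.app _) ?_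
  refine (congrArg ((((Ind.{v, u} κ).mapComp (c.π i) (C.map f.toLoc)).inv.toNatTrans.app P).hom.app
    _) (ind_mapComp_indUnit (c.π i) (C.map f.toLoc) P p).symm).trans ?_
  have h := Cat.Hom.hom_inv_id_toNatTrans_app
    ((Ind.{v, u} κ).mapComp (c.π i) (C.map f.toLoc)) P
  exact congr(($h).hom.app _ (indUnit κ (c.π i ≫ C.map f.toLoc) P p))

end

/-! ### The comparison functor is fully faithful and essentially surjective -/

section

variable {κ : Cardinal.{v}} [Fact κ.IsRegular] {J : Type v} [Category.{v} J]
  (C : LocallyDiscrete J ⥤ᵖ Cat.{v, max u v})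

variable (κ) in
/-- The canonical functor from ind-objects in a pseudo-limit to the pseudo-limit of the categories
of ind-objects. -/
noncomputable abbrev indComparison :
    (Ind.{v, u} κ).obj (Cat.of (PseudoLimit C)) ⥤ PseudoLimit (C.comp (Ind.{v, u} κ)) :=
  ((PseudoLimit.cone.{v, u} C).map (Ind.{v, u} κ)).lift

variable {C}

/-- The compatible families of elements attached to the elements of an ind-object in a
pseudo-limit. -/
noncomputable def toSections (P : (Ind.{v, u} κ).obj (Cat.of (PseudoLimit C))) :
    P.obj ⟶ (indSystem ((indComparison κ C).obj P)).sections where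
  app Y := ↾fun p =>
    { el := fun j => indUnit κ ((PseudoLimit.cone.{v, u} C).π j) P p
      compat := fun f => indTr_indUnit (PseudoLimit.cone.{v, u} C) P f p }
  naturality Y Y' f := by
    refine ConcreteCategory.hom_ext _ _ fun p => ?_
    refine PresheafSystem.Section.ext (funext fun j => ?_)
    exact indUnit_map ((PseudoLimit.cone.{v, u} C).π j) P f.unop p

/-- A presentation of `P` also presents the sections of its image, with the generators matching
under `toSections`. -/
theorem isIso_toSections (hJ : HasCardinalLT (Arrow J) κ)
    (P : (Ind.{v, u} κ).obj (Cat.of (PseudoLimit C))) : IsIso (toSections P) := by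
  obtain ⟨I, _, hI, K, x, h⟩ := IsIndObj.exists_isPresentation.{v, u} P.property
  have := isFiltered_of_isCardinalFiltered I κ
  exact h.isIso ((indSystem ((indComparison κ C).obj P)).sections_isPresentation hJ K
    (fun i => (toSections P).app _ (x i)) fun j =>
      isPresentation_indUnit ((PseudoLimit.cone.{v, u} C).π j) P h) (toSections P) fun _ => rfl

theorem toSections_map {P Q : (Ind.{v, u} κ).obj (Cat.of (PseudoLimit C))} (g : P ⟶ Q)
    {Y : PseudoLimit C} (p : P.obj.obj (op Y)) (j : J) :
    PresheafSystem.Section.el ((toSections Q).app (op Y) (g.hom.app _ p)) j =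
      (((indComparison κ C).map g).app j).hom.app _
        (PresheafSystem.Section.el ((toSections P).app (op Y) p) j) :=
  (ind_map_map_indUnit ((PseudoLimit.cone.{v, u} C).π j) g p).symm

theorem indComparison_faithful (hJ : HasCardinalLT (Arrow J) κ) :
    (indComparison κ C).Faithful where
  map_injective {P Q} f g h := by
    obtain ⟨r, hr, -⟩ := (isIso_toSections hJ Q).out
    refine ObjectProperty.hom_ext _ (NatTrans.ext (funext fun Y =>
      ConcreteCategory.hom_ext _ _ fun p => ?_))
    have e : (toSections Q).app Y (f.hom.app Y p) = (toSections Q).app Y (g.hom.app Y p) := by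
      refine PresheafSystem.Section.ext (funext fun j => ?_)
      refine (toSections_map f p j).trans (Eq.trans ?_ (toSections_map g p j).symm)
      rw [h]
    have hr' (q : Q.obj.obj Y) : r.app Y ((toSections Q).app Y q) = q :=
      ConcreteCategory.congr_hom (congr_app hr Y) q
    exact (hr' _).symm.trans ((congrArg (r.app Y) e).trans (hr' _))

/-- The action of a morphism between families of ind-objects on compatible families of
elements. -/
def sectionsMap {X X' : PseudoLimit (C.comp (Ind.{v, u} κ))} (g : X ⟶ X') :
    (indSystem X).sections ⟶ (indSystem X').sections where
  app Y := ↾fun s =>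
    { el := fun j => (g.app j).hom.app _ (PresheafSystem.Section.el s j)
      compat := fun {i j} f => by
        refine (indTr_naturality g f _).symm.trans ?_
        refine (congrArg ((g.app j).hom.app _) (PresheafSystem.Section.compat s f)).trans ?_
        exact ind_hom_map_apply _ _ _ }
  naturality Y Y' f := by
    refine ConcreteCategory.hom_ext _ _ fun s => ?_
    refine PresheafSystem.Section.ext (funext fun j => ?_)
    exact ind_hom_map_apply _ _ _

theorem indComparison_full (hJ : HasCardinalLT (Arrow J) κ) :
    (indComparison κ C).Full where
  map_surjective {P Q} h := by
    obtain ⟨r, -, hr⟩ := (isIso_toSections hJ Q).out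
    let g : P ⟶ Q := ObjectProperty.homMk (toSections P ≫ sectionsMap h ≫ r)
    refine ⟨g, PseudoLimit.Hom.ext (funext fun j => ?_)⟩
    refine ind_hom_ext ((PseudoLimit.cone.{v, u} C).π j) P _ fun Y p => ?_
    refine (toSections_map g p j).symm.trans ?_
    have e : g.hom ≫ toSections Q = toSections P ≫ sectionsMap h := by
      refine (Category.assoc _ _ _).trans (congrArg (_ ≫ ·) ?_)
      exact (Category.assoc _ _ _).trans ((congrArg (_ ≫ ·) hr).trans (Category.comp_id _))
    exact congr(PresheafSystem.Section.el (NatTrans.app $e (op Y) p) j)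

/-- The preimage is the presheaf of sections. Evaluation at `j` extends along the Kan extension to a
map to `X j`, an isomorphism because the projection of `D` presents both sides. -/
theorem exists_iso_indComparison (X : PseudoLimit (C.comp (Ind.{v, u} κ)))
    (hJ : HasCardinalLT (Arrow J) κ) {I : Type v} [SmallCategory I] [IsCardinalFiltered I κ]
    (D : I ⥤ PseudoLimit C) (x : ∀ i, (indSystem X).sections.obj (op (D.obj i)))
    (h : ∀ j, IsPresentation (D ⋙ PseudoLimit.proj C j) (X.obj j).obj
      (fun i => PresheafSystem.Section.el (x i) j)) :
    ∃ P, Nonempty ((indComparison κ C).obj P ≅ X) := by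
  have := isFiltered_of_isCardinalFiltered I κ
  have hs := (indSystem X).sections_isPresentation hJ D x h
  let P : (Ind.{v, u} κ).obj (Cat.of (PseudoLimit C)) :=
    ⟨(indSystem X).sections, hs.isIndObj.{v, u}⟩
  have hg (j : J) : ∃ a : ((indComparison κ C).obj P).obj j ⟶ X.obj j,
      ∀ (Y : PseudoLimit C) (s : P.obj.obj (op Y)),
        a.hom.app _ (indUnit κ ((PseudoLimit.cone.{v, u} C).π j) P s) =
          PresheafSystem.Section.el s j :=
    exists_ind_desc ((PseudoLimit.cone.{v, u} C).π j) P (X.obj j)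
      { app := fun Y => ↾fun s => PresheafSystem.Section.el s j
        naturality := fun _ _ _ => rfl }
  choose g hg using hg
  have hg' (j : J) : IsIso (g j) := by
    have : IsIso (g j).hom := (isPresentation_indUnit ((PseudoLimit.cone.{v, u} C).π j) P hs).isIso
      (h j) (g j).hom fun i => hg j _ (x i)
    exact (ObjectProperty.isIso_hom_iff _).1 this
  let G : (indComparison κ C).obj P ⟶ X := homOfIndTr g fun {i j} f c y => by
    -- Every element of a Kan-extended ind-object is a restriction of a unit element, so
    -- compatibility with transitions reduces to that of the section `s`.
    obtain ⟨Y, s, a, rfl⟩ := exists_indUnit ((PseudoLimit.cone.{v, u} C).π i) P y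
    have h₁ := (indSystem ((indComparison κ C).obj P)).tr_map f a
      (indUnit κ ((PseudoLimit.cone.{v, u} C).π i) P s)
    have h₂ := (indSystem X).tr_map f a (PresheafSystem.Section.el s i)
    refine (congrArg ((g j).hom.app _) h₁).trans ((ind_hom_map_apply _ _ _).trans ?_)
    refine Eq.trans ?_ (congrArg (indTr X f) ((ind_hom_map_apply (g i) a _).trans
      (congrArg _ (hg i Y s)))).symm
    refine Eq.trans (congrArg _ ?_) h₂.symm
    refine (congrArg ((g j).hom.app _)
      (indTr_indUnit (PseudoLimit.cone.{v, u} C) P f s)).trans ?_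
    refine (ind_hom_map_apply _ _ _).trans ((congrArg _ (hg j Y s)).trans ?_)
    exact (PresheafSystem.Section.compat s f).symm
  have : IsIso G := PseudoLimit.isIso_of_app G hg'
  exact ⟨P, ⟨asIso G⟩⟩

end

theorem preservesPseudoLimit_ind {κ : Cardinal.{v}} [Fact κ.IsRegular] {ι : Type v} [LinearOrder ι]
    [WellFoundedLT ι] (hι : HasCardinalLT ι κ) (C : LocallyDiscrete ιᵒᵖ ⥤ᵖ Cat.{v, max u v})
    (hC : ∀ γ, IsStreetFibration (comparisonBelow C γ)) :
    PreservesPseudoLimit.{v, u} (Ind.{v, u} κ) C := by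
  have hJ : HasCardinalLT (Arrow ιᵒᵖ) κ :=
    hasCardinalLT_arrow_of_isThin (hι.of_injective unop unop_injective)
  have := indComparison_faithful (C := C) hJ
  have := indComparison_full (C := C) hJ
  have : (indComparison κ C).EssSurj := ⟨fun X => by
    obtain ⟨I, _, _, D, x, h⟩ := (indSystem_isInd X).exists_isPresentation hι hC
    exact exists_iso_indComparison X hJ D x h⟩
  exact { }

end IndTower

theorem mainTheorem4 (κ : Cardinal.{v}) [Fact κ.IsRegular] (α : Ordinal.{v}) (hα : α < κ.ord)
    (C : LocallyDiscrete (α.ToType)ᵒᵖ ⥤ᵖ Cat.{v, max u v})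
    (hC : ∀ γ : α.ToType, IndTower.IsStreetFibration (IndTower.comparisonBelow C γ)) :
    IndTower.PreservesPseudoLimit.{v, u} (IndTower.Ind.{v, u} κ) C := by
  refine IndTower.preservesPseudoLimit_ind ?_ C hC
  rw [hasCardinalLT_iff_cardinal_mk_lt, Cardinal.mk_toType]
  exact Cardinal.lt_ord.1 hα
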